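/- Let $\mathbb H$ be the field of quaternions and let $\mathfrak H$ be a (complete) right quaternionic Hilbert space whose inner product $\langle\cdot\mid\cdot\rangle$ is right linear in the second variable, with an orthonormal Hilbert basis $(e_n)_{n\ge 0}$. For $\mathfrak q\in\mathbb H$ let $\mathfrak q\cdot\phi=\sum_{n} e_n\,\mathfrak q\,\langle e_n\mid\phi\rangle$ be the left multiplication on $\mathfrak H$ induced by this basis, and let $$\mathsf a=\sum_{m\ge 0}\sqrt{m+1}\,|e_m\rangle\langle e_{m+1}|,\qquad \mathsf a^\dagger=\sum_{m\ge 0}\sqrt{m+1}\,|e_{m+1}\rangle\langle e_m|$$ be the annihilation and creation operators, each on its maximal domain (all $\phi$ for which the defining series, applied to $\phi$, converges in $\mathfrak H$). Let $D(\mathfrak q)=e^{\mathfrak q\cdot\mathsf a^\dagger-\bar{\mathfrak q}\cdot\mathsf a}$ be the displacement operator, the exponential of $A=\mathfrak q\cdot\mathsf a^\dagger-\bar{\mathfrak q}\cdot\mathsf a$ (with domain $\operatorname{dom}\mathsf a\cap\operatorname{dom}\mathsf a^\dagger$) being given by the series $\sum_k A^k\phi/k!$ on the set of all $\phi$ for which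 every $A^k\phi$ is defined and $\sum_k\|A^k\phi\|/k!<\infty$, and extended to $\mathfrak H$ by continuity. Let $\tau$ be a quaternionic imaginary unit (a purely imaginary quaternion of norm $1$), and let $D_\tau(\mathfrak q)$ denote $D(\mathfrak q)$ for $\mathfrak q=x+\tau y$ in the slice $\mathbb C_\tau=\mathbb R+\tau\mathbb R$. Then for all $x,y\in\mathbb R$ and $\mathfrak q=x+\tau y$, the operator $D_\tau(\mathfrak q)$ is well defined on all of $\mathfrak H$ (the set on which the exponential series is used is dense and the extension by continuity exists), and (i) $\displaystyle \frac12\Big(\frac{\partial}{\partial x}-\tau\frac{\partial}{\partial y}\Big)D_\tau(\mathfrak q)=\Big(\mathsf a^\dagger-\frac12\bar{\mathfrak q}\Big)D_\tau(\mathfrak q)$; (ii) $\displaystyle \frac12\Big(\frac{\partial}{\partial x}+\tau\frac{\partial}{\partial y}\Big)D_\tau(\mathfrak q)=-\Big(\mathsf a-\frac12\mathfrak q\Big)D_\tau(\mathfrak q)$, where quaternions act on vectors by the left multiplication, and the identities are understood strongly on the natural domain of the right-hand side: a vector $\phi$ satisfies $D_\tau(\mathfrak q)\phi\in\operatorname{dom}\mathsf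 a^\dagger$ if and only if $\phi\in\operatorname{dom}\mathsf a^\dagger$ (respectively with $\mathsf a$ in place of $\mathsf a^\dagger$), and for every such $\phi$ the partial derivatives of $(x,y)\mapsto D_\tau(x+\tau y)\phi$ with respect to $x$ and to $y$ exist in the norm of $\mathfrak H$ and the identity (i) (respectively (ii)), applied to $\phi$, holds. -/

import Mathlib

open scoped Quaternion Topology Nat
open MulOpposite

namespace QuaternionicFock

/-- A right quaternionic inner product space: a right module over the quaternions (scalars act
through the opposite ring, `op q • f` is the vector `f q`) with a quaternion valued inner product
that is additive and right linear in the second variable, conjugate symmetric, and induces the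
norm.  The real scalar multiplication is the restriction of the quaternionic one. -/
class RightInnerProductSpace (H : Type*) [NormedAddCommGroup H] [NormedSpace ℝ H]
    extends Module ℍ[ℝ]ᵐᵒᵖ H where
  /-- the inner product `⟨f | g⟩` -/
  qinner : H → H → ℍ[ℝ]
  star_qinner : ∀ f g : H, star (qinner f g) = qinner g f
  qinner_add_right : ∀ f g h : H, qinner f (g + h) = qinner f g + qinner f h
  qinner_smul_right : ∀ (f g : H) (q : ℍ[ℝ]), qinner f (op q • g) = qinner f g * q
  qinner_self : ∀ f : H, qinner f f = ((‖f‖ ^ 2 : ℝ) : ℍ[ℝ])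
  real_smul_eq : ∀ (r : ℝ) (f : H), r • f = op (r : ℍ[ℝ]) • f

open RightInnerProductSpace

/-- An orthonormal (Hilbert) basis `e 0, e 1, e 2, …` of a right quaternionic inner product
space: an orthonormal sequence whose right linear span is dense. -/
structure OrthonormalBasisSeq (H : Type*) [NormedAddCommGroup H] [NormedSpace ℝ H]
    [RightInnerProductSpace H] where
  /-- the basis vectors -/
  vec : ℕ → H
  orthonormal : ∀ m n : ℕ, qinner (vec m) (vec n) = if m = n then 1 else 0
  dense_span : Dense (Submodule.span ℍ[ℝ]ᵐᵒᵖ (Set.range vec) : Set H)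

section Basic

variable {H : Type*} [NormedAddCommGroup H] [NormedSpace ℝ H] [RightInnerProductSpace H]

theorem qinner_add_left (f g h : H) : qinner (f + g) h = qinner f h + qinner g h := by
  rw [← star_qinner, qinner_add_right, star_add, star_qinner, star_qinner]

theorem qinner_smul_left (f g : H) (q : ℍ[ℝ]) :
    qinner (op q • f) g = star q * qinner f g := by
  rw [← star_qinner, qinner_smul_right, star_mul, star_qinner]

theorem norm_op_smul (q : ℍ[ℝ]) (f : H) : ‖op q • f‖ = ‖f‖ * ‖q‖ := by
  have h : ((‖op q • f‖ ^ 2 : ℝ) : ℍ[ℝ]) = (((‖f‖ * ‖q‖) ^ 2 : ℝ) : ℍ[ℝ]) := by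
    rw [← qinner_self, qinner_smul_right, qinner_smul_left, qinner_self, mul_assoc,
      Quaternion.coe_commutes, ← mul_assoc, Quaternion.star_mul_self,
      Quaternion.normSq_eq_norm_mul_self, ← Quaternion.coe_mul]
    congr 1
    ring
  exact (pow_left_inj₀ (norm_nonneg _) (by positivity) two_ne_zero).1
    (Quaternion.coe_injective h)

theorem continuousConstSMul : ContinuousConstSMul ℍ[ℝ]ᵐᵒᵖ H := by
  refine ⟨fun q => ?_⟩
  refine AddMonoidHomClass.continuous_of_bound (DistribSMul.toAddMonoidHom H q) ‖unop q‖ ?_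
  intro f
  have := norm_op_smul (unop q) f
  rw [op_unop] at this
  rw [DistribSMul.toAddMonoidHom_apply, this, mul_comm]

/-- The underlying real inner product, used only to establish convergence. -/
@[reducible] def realInnerProductSpace : InnerProductSpace ℝ H where
  inner f g := (qinner f g).re
  norm_sq_eq_re_inner f := by
    change ‖f‖ ^ 2 = (qinner f f).re
    rw [qinner_self, Quaternion.re_coe]
  conj_inner_symm f g := by
    change (qinner g f).re = (qinner f g).re
    rw [← star_qinner f g, Quaternion.re_star]
  add_left f g h := by
    change (qinner (f + g) h).re = (qinner f h).re + (qinner g h).re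
    rw [qinner_add_left, Quaternion.re_add]
  smul_left f g r := by
    change (qinner (r • f) g).re = r * (qinner f g).re
    rw [real_smul_eq, qinner_smul_left]
    simp

variable (e : OrthonormalBasisSeq H)

theorem norm_vec (n : ℕ) : ‖e.vec n‖ = 1 := by
  have h := e.orthonormal n n
  rw [qinner_self, if_pos rfl, ← Quaternion.coe_one] at h
  have h' := Quaternion.coe_injective h
  exact (pow_eq_one_iff_of_nonneg (norm_nonneg _) two_ne_zero).1 h'

theorem bessel (f : H) : Summable fun n => ‖qinner (e.vec n) f‖ ^ 2 := by
  classical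
  let _ : InnerProductSpace ℝ H := realInnerProductSpace
  let c : ℕ → ℍ[ℝ] := fun n => qinner (e.vec n) f
  let u : ℕ → ℍ[ℝ] := fun n => if c n = 0 then 1 else (‖c n‖⁻¹ : ℝ) • c n
  have hu : ∀ n, ‖u n‖ = 1 := by
    intro n
    by_cases h : c n = 0
    · simp [u, h]
    · simp [u, h, norm_smul]
  have ho : Orthonormal ℝ fun n => op (u n) • e.vec n := by
    refine ⟨fun n => by rw [norm_op_smul, norm_vec, hu, one_mul], fun m n hmn => ?_⟩
    change (qinner (op (u m) • e.vec m) (op (u n) • e.vec n)).re = 0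
    rw [qinner_smul_right, qinner_smul_left, e.orthonormal, if_neg hmn]
    simp
  refine (ho.inner_products_summable (x := f)).congr fun n => ?_
  congr 1
  change ‖(qinner (op (u n) • e.vec n) f).re‖ = ‖c n‖
  rw [qinner_smul_left]
  change ‖(star (u n) * c n).re‖ = ‖c n‖
  by_cases h : c n = 0
  · simp [h]
  · have hn : ‖c n‖ ≠ 0 := norm_ne_zero_iff.2 h
    have h1 : star (u n) * c n = (‖c n‖ : ℍ[ℝ]) := by
      simp only [u, h, if_false]
      rw [Quaternion.star_smul, smul_mul_assoc, Quaternion.star_mul_self,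
        Quaternion.normSq_eq_norm_mul_self, Quaternion.smul_coe, inv_mul_cancel_left₀ hn]
    rw [h1, Quaternion.re_coe, norm_norm]

theorem summable_of_sq [CompleteSpace H] {c : ℕ → ℍ[ℝ]} (hc : Summable fun n => ‖c n‖ ^ 2) :
    Summable fun n => op (c n) • e.vec n := by
  let _ : InnerProductSpace ℝ H := realInnerProductSpace
  let V : ℕ → ℍ[ℝ] →ₗᵢ[ℝ] H := fun n =>
    { toFun := fun q => op q • e.vec n
      map_add' := fun p q => by rw [op_add, add_smul]
      map_smul' := fun r q => by
        rw [RingHom.id_apply, real_smul_eq r (op q • e.vec n), smul_smul, ← op_mul,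
          ← Quaternion.coe_commutes, Quaternion.coe_mul_eq_smul]
      norm_map' := fun q => by
        change ‖op q • e.vec n‖ = ‖q‖
        rw [norm_op_smul, norm_vec, one_mul] }
  have hV : OrthogonalFamily ℝ (fun _ : ℕ => ℍ[ℝ]) V := by
    intro m n hmn p q
    change (qinner (op p • e.vec m) (op q • e.vec n)).re = 0
    rw [qinner_smul_right, qinner_smul_left, e.orthonormal, if_neg hmn]
    simp
  exact (hV.summable_iff_norm_sq_summable c).2 hc

theorem summable_leftMul [CompleteSpace H] (q : ℍ[ℝ]) (f : H) :
    Summable fun n => op (q * qinner (e.vec n) f) • e.vec n := by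
  refine summable_of_sq e (((bessel e f).mul_left (‖q‖ ^ 2)).congr fun n => ?_)
  rw [norm_mul, mul_pow]

end Basic

section Operators

variable {H : Type*} [NormedAddCommGroup H] [NormedSpace ℝ H] [RightInnerProductSpace H]

/-- The left scalar multiplication `q · f = ∑ₙ eₙ q ⟨eₙ | f⟩` induced by the basis `e`,
as a right linear operator in `f`. -/
noncomputable def leftMul [CompleteSpace H] (e : OrthonormalBasisSeq H) (q : ℍ[ℝ]) :
    H →ₗ[ℍ[ℝ]ᵐᵒᵖ] H where
  toFun f := ∑' n, op (q * qinner (e.vec n) f) • e.vec n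
  map_add' f g := by
    rw [← (summable_leftMul e q f).tsum_add (summable_leftMul e q g)]
    simp only [qinner_add_right, mul_add, op_add, add_smul]
  map_smul' p f := by
    have : ContinuousConstSMul ℍ[ℝ]ᵐᵒᵖ H := continuousConstSMul
    rw [RingHom.id_apply, ← (summable_leftMul e q f).tsum_const_smul p]
    congr 1
    funext n
    rw [← op_unop p, qinner_smul_right, smul_smul, ← op_mul, mul_assoc]

/-- A weighted shift operator `f ↦ ∑ₘ e_{s m} w_m ⟨e_{t m} | f⟩` with real weights `w`, defined on
the domain of all vectors for which the series converges. -/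
noncomputable def weightedShift (e : OrthonormalBasisSeq H) (w : ℕ → ℝ) (s t : ℕ → ℕ) :
    H →ₗ.[ℍ[ℝ]ᵐᵒᵖ] H where
  domain :=
    { carrier := {f | Summable fun m => op ((w m : ℍ[ℝ]) * qinner (e.vec (t m)) f) • e.vec (s m)}
      add_mem' := fun {f g} hf hg => by
        refine (Summable.add hf hg).congr fun m => ?_
        rw [qinner_add_right, mul_add, op_add, add_smul]
      zero_mem' := by
        have h : ∀ g : H, qinner g (0 : H) = 0 := fun g => by
          have := qinner_add_right g 0 0
          simpa using this
        simp only [Set.mem_ofPred_eq, h, mul_zero, op_zero, zero_smul]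
        exact summable_zero
      smul_mem' := fun p f hf => by
        have : ContinuousConstSMul ℍ[ℝ]ᵐᵒᵖ H := continuousConstSMul
        refine (Summable.const_smul p hf).congr fun m => ?_
        rw [← op_unop p, qinner_smul_right, smul_smul, ← op_mul, mul_assoc] }
  toFun :=
    { toFun := fun f => ∑' m, op ((w m : ℍ[ℝ]) * qinner (e.vec (t m)) (f : H)) • e.vec (s m)
      map_add' := fun f g => by
        rw [← Summable.tsum_add f.2 g.2]
        simp only [Submodule.coe_add, qinner_add_right, mul_add, op_add, add_smul]
      map_smul' := fun p f => by
        have : ContinuousConstSMul ℍ[ℝ]ᵐᵒᵖ H := continuousConstSMul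
        rw [RingHom.id_apply, ← Summable.tsum_const_smul p f.2]
        congr 1
        funext m
        rw [Submodule.coe_smul, ← op_unop p, qinner_smul_right, smul_smul, ← op_mul, mul_assoc] }

/-- The annihilation operator `a = ∑ₘ √(m+1) |eₘ⟩⟨eₘ₊₁|` on its maximal domain. -/
noncomputable def annihilation (e : OrthonormalBasisSeq H) : H →ₗ.[ℍ[ℝ]ᵐᵒᵖ] H :=
  weightedShift e (fun m => √((m : ℝ) + 1)) (fun m => m) (fun m => m + 1)

/-- The creation operator `a† = ∑ₘ √(m+1) |eₘ₊₁⟩⟨eₘ|` on its maximal domain. -/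
noncomputable def creation (e : OrthonormalBasisSeq H) : H →ₗ.[ℍ[ℝ]ᵐᵒᵖ] H :=
  weightedShift e (fun m => √((m : ℝ) + 1)) (fun m => m + 1) (fun m => m)

open Classical in
/-- One application of a partially defined operator (zero outside the domain). -/
noncomputable def applyTotal (T : H →ₗ.[ℍ[ℝ]ᵐᵒᵖ] H) (f : H) : H :=
  if h : f ∈ T.domain then T ⟨f, h⟩ else 0

/-- The vectors `f` on which all powers of `T` are defined and for which the exponential series
`∑ₖ Tᵏ f / k!` converges absolutely. -/
def expDomain (T : H →ₗ.[ℍ[ℝ]ᵐᵒᵖ] H) : Set H :=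
  {f | (∀ k : ℕ, (applyTotal T)^[k] f ∈ T.domain) ∧
    Summable fun k : ℕ => ‖(applyTotal T)^[k] f‖ / (k ! : ℝ)}

/-- The exponential series `∑ₖ Tᵏ f / k!`, to be used for `f` in `expDomain T`. -/
noncomputable def expSeries (T : H →ₗ.[ℍ[ℝ]ᵐᵒᵖ] H) (f : H) : H :=
  ∑' k : ℕ, (k ! : ℝ)⁻¹ • (applyTotal T)^[k] f

/-- The operator exponential `e^T`: the exponential series on `expDomain T`, extended by
continuity to the whole space. -/
noncomputable def opExp (T : H →ₗ.[ℍ[ℝ]ᵐᵒᵖ] H) : H → H :=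
  extendFrom (expDomain T) (expSeries T)

/-- The exponential `e^T` is well defined on the whole space: the series converges on a dense set
and extends continuously (the limits defining `opExp T` exist everywhere). -/
def ExpWellDefined (T : H →ₗ.[ℍ[ℝ]ᵐᵒᵖ] H) : Prop :=
  Dense (expDomain T) ∧
    ∀ f : H, Filter.Tendsto (expSeries T) (𝓝[expDomain T] f) (𝓝 (opExp T f))

variable [CompleteSpace H]

/-- The operator `q · a† - q̄ · a`, with domain `dom a† ∩ dom a`. -/
noncomputable def displacementGenerator (e : OrthonormalBasisSeq H) (q : ℍ[ℝ]) :
    H →ₗ.[ℍ[ℝ]ᵐᵒᵖ] H :=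
  (leftMul e q).compPMap (creation e) - (leftMul e (star q)).compPMap (annihilation e)

/-- The displacement operator `D(q) = e^{q · a† - q̄ · a}`. -/
noncomputable def displacement (e : OrthonormalBasisSeq H) (q : ℍ[ℝ]) : H → H :=
  opExp (displacementGenerator e q)

/-- The sphere `𝕊` of quaternionic imaginary units. -/
def imaginarySphere : Set ℍ[ℝ] :=
  {τ | τ.re = 0 ∧ τ.imI ^ 2 + τ.imJ ^ 2 + τ.imK ^ 2 = 1}

/-- The point `x + τ y` of the slice `ℂ_τ`. -/
noncomputable def slicePoint (τ : ℍ[ℝ]) (x y : ℝ) : ℍ[ℝ] := (x : ℍ[ℝ]) + τ * (y : ℍ[ℝ])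

/-- The displacement operator restricted to the slice `ℂ_τ`, in the real coordinates `(x, y)`. -/
noncomputable def sliceDisplacement (e : OrthonormalBasisSeq H) (τ : ℍ[ℝ]) (x y : ℝ) : H → H :=
  displacement e (slicePoint τ x y)

end Operators

end QuaternionicFock

/-! Write `A_q = q a† - q̄ a`. In coordinates, vectors become quaternion sequences on which `q`
multiplies from the left and `a`, `a†` act with real weights. Everywhere on sequences `[a, a†] = 1`,
hence `[a†, A_q] = q̄`, `[a, A_q] = q` and, when `p` commutes with `q` and `q̄`, `[A_p, A_q] = p q̄
- p̄ q`. The last commutator is a left multiplication that again commutes with `A_q`. Central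
commutators give `a† e^A = e^A (a† + q̄)`, `a e^A = e^A (a + q)`, and the derivative of `e^{A_q}` in
the direction `p`, namely `e^{A_q} (A_p + ½ [A_p, A_q])`. Taking `p = 1` and `p = τ` and using `τ² =
-1`, the two Wirtinger combinations reduce to the claimed formulas.

The analysis starts from finitely supported sequences. There the exponential series converges
absolutely, since `‖A^k c‖` grows only like `√(k!)` up to a geometric factor
(`sum_norm_gen_pow_le`). Skew-symmetry of `A` makes the sum norm preserving (`norm_expVec`), so it
extends to an isometry `expIsometry` of the whole space.

This isometry is the displacement operator: a convergent exponential series at any vector, finitely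
supported or not, is determined by its pairings with finite vectors, where the powers of `A` can be
moved to the other side (`eq_expIsometry_of_hasSum`). Intertwining and differentiability then pass
from truncations to the domains, the latter because an isometry makes the convergence of derivatives
uniform in the parameter (`hasDerivAt_expIsometry`). -/

namespace QuaternionicFock

open RightInnerProductSpace Filter

/-! ### Coordinates in the basis: Cauchy–Schwarz, completeness, Riesz–Fischer. -/

section Coordinates

variable {H : Type*} [NormedAddCommGroup H] [NormedSpace ℝ H] [RightInnerProductSpace H]

/-- The Cauchy–Schwarz inequality. -/
theorem norm_qinner_le (f g : H) : ‖qinner f g‖ ≤ ‖f‖ * ‖g‖ := by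
  let _ : InnerProductSpace ℝ H := realInnerProductSpace
  set w := qinner f g with hw
  -- Rotating `f` by `w = ⟨f | g⟩` makes the inner product the real number `‖w‖²`, so the real
  -- inequality applies, and one factor `‖w‖` is cancelled at the end.
  have h : (qinner (op w • f) g).re ≤ ‖op w • f‖ * ‖g‖ :=
    real_inner_le_norm (op w • f) g
  rw [qinner_smul_left, ← hw, Quaternion.star_mul_self, Quaternion.re_coe,
    Quaternion.normSq_eq_norm_mul_self, norm_op_smul] at h
  rcases (norm_nonneg w).eq_or_lt with h0 | h0
  · rw [← h0]; positivity
  · refine le_of_mul_le_mul_right ?_ h0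
    linarith

theorem real_smul_op_smul (r : ℝ) (q : ℍ[ℝ]) (v : H) : op (r • q) • v = r • op q • v := by
  rw [real_smul_eq r (op q • v), smul_smul, ← op_mul, ← Quaternion.coe_commutes,
    Quaternion.coe_mul_eq_smul]

theorem qinner_real_smul_right (r : ℝ) (f g : H) : qinner f (r • g) = r • qinner f g := by
  rw [real_smul_eq, qinner_smul_right, ← Quaternion.coe_commutes, Quaternion.coe_mul_eq_smul]

/-- The bounded functional `g ↦ ⟨f | g⟩`, over the reals. -/
noncomputable def qinnerCLM (f : H) : H →L[ℝ] ℍ[ℝ] :=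
  LinearMap.mkContinuous
    { toFun := qinner f
      map_add' := qinner_add_right f
      map_smul' := fun r g => qinner_real_smul_right r f g } ‖f‖ (norm_qinner_le f)

@[simp] theorem qinnerCLM_apply (f g : H) : qinnerCLM f g = qinner f g := rfl

/-- The bounded operator `q ↦ v q`, over the reals. -/
noncomputable def ket (v : H) : ℍ[ℝ] →L[ℝ] H :=
  LinearMap.mkContinuous
    { toFun := fun q => op q • v
      map_add' := fun p q => by rw [op_add, add_smul]
      map_smul' := fun r q => real_smul_op_smul r q v } ‖v‖ (fun q => (norm_op_smul q v).le)

@[simp] theorem ket_apply (v : H) (q : ℍ[ℝ]) : ket v q = op q • v := rfl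

variable (e : OrthonormalBasisSeq H)

/-- The coordinates of a vector in the basis `e`. -/
noncomputable def coords : H →ₗ[ℝ] (ℕ → ℍ[ℝ]) where
  toFun f n := qinner (e.vec n) f
  map_add' f g := funext fun n => qinner_add_right (e.vec n) f g
  map_smul' r f := funext fun n => qinner_real_smul_right r (e.vec n) f

theorem coords_apply (f : H) (n : ℕ) : coords e f n = qinner (e.vec n) f := rfl

theorem continuous_coords (n : ℕ) : Continuous fun f : H => coords e f n :=
  (qinnerCLM (e.vec n)).continuous

theorem qinner_eq_zero_of_coords {f : H} (hf : coords e f = 0) (g : H) : qinner g f = 0 := by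
  have hc : Continuous fun g : H => qinner f g := (qinnerCLM f).continuous
  have hz : ∀ h : H, qinner h (0 : H) = 0 := fun h => (qinnerCLM h).map_zero
  have hspan : ∀ g ∈ Submodule.span ℍ[ℝ]ᵐᵒᵖ (Set.range e.vec), qinner f g = 0 := by
    intro g hg
    induction hg using Submodule.span_induction with
    | mem g hg =>
      obtain ⟨n, rfl⟩ := hg
      rw [← star_qinner, ← coords_apply, hf]
      simp
    | zero => exact hz f
    | add g h _ _ hg hh => rw [qinner_add_right, hg, hh, add_zero]
    | smul q g _ hg => rw [← op_unop q, qinner_smul_right, hg, zero_mul]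
  have : qinner f g = 0 :=
    congrFun (hc.ext_on e.dense_span continuous_const hspan) g
  rw [← star_qinner, this, star_zero]

theorem coords_injective : Function.Injective (coords e) := by
  rw [injective_iff_map_eq_zero]
  intro f hf
  have h := qinner_eq_zero_of_coords e hf f
  rw [qinner_self, ← Quaternion.coe_zero] at h
  simpa using Quaternion.coe_injective h

/-- The vector `∑ₙ eₙ cₙ` with prescribed square summable coordinates. -/
noncomputable def synth (c : ℕ → ℍ[ℝ]) : H := ∑' n, op (c n) • e.vec n

theorem coords_of_hasSum {c : ℕ → ℍ[ℝ]} {f : H} (h : HasSum (fun n => op (c n) • e.vec n) f) :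
    coords e f = c := by
  funext n
  have h1 : HasSum (fun m => qinner (e.vec n) (op (c m) • e.vec m)) (qinner (e.vec n) f) :=
    (qinnerCLM (e.vec n)).hasSum h
  refine h1.unique ?_
  convert hasSum_ite_eq n (c n) using 2 with m
  rw [qinner_smul_right, e.orthonormal]
  split_ifs with h1 h2 h2
  · rw [h1, one_mul]
  · exact absurd h1.symm h2
  · exact absurd h2.symm h1
  · rw [zero_mul]

variable [CompleteSpace H]

theorem summable_coords (f : H) : Summable fun n => op (coords e f n) • e.vec n :=
  summable_of_sq e (bessel e f)

theorem hasSum_coords (f : H) : HasSum (fun n => op (coords e f n) • e.vec n) f := by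
  have h := (summable_coords e f).hasSum
  rwa [coords_injective e (coords_of_hasSum e h)] at h

theorem exists_coords_iff_summable {c : ℕ → ℍ[ℝ]} :
    (∃ f : H, coords e f = c) ↔ Summable fun n => op (c n) • e.vec n := by
  constructor
  · rintro ⟨f, rfl⟩
    exact summable_coords e f
  · intro h
    exact ⟨_, coords_of_hasSum e h.hasSum⟩

theorem exists_coords_iff_sq {c : ℕ → ℍ[ℝ]} :
    (∃ f : H, coords e f = c) ↔ Summable fun n => ‖c n‖ ^ 2 := by
  constructor
  · rintro ⟨f, rfl⟩
    exact bessel e f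
  · intro h
    exact (exists_coords_iff_summable e).2 (summable_of_sq e h)

@[simp] theorem coords_leftMul (q : ℍ[ℝ]) (f : H) (n : ℕ) :
    coords e (leftMul e q f) n = q * coords e f n :=
  congrFun (coords_of_hasSum e (summable_leftMul e q f).hasSum) n

end Coordinates

/-! ### Operator algebra on all sequences, where no domains intervene, and growth of powers of the
generator. -/

section Sequences

/-- The annihilation operator on arbitrary coordinate sequences. -/
noncomputable def lower : Module.End ℝ (ℕ → ℍ[ℝ]) where
  toFun c n := √((n : ℝ) + 1) • c (n + 1)
  map_add' c d := funext fun n => smul_add _ (c (n + 1)) (d (n + 1))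
  map_smul' r c := funext fun n => smul_comm _ r (c (n + 1))

/-- The creation operator on arbitrary coordinate sequences. -/
noncomputable def raise : Module.End ℝ (ℕ → ℍ[ℝ]) where
  toFun c n := √(n : ℝ) • c (n - 1)
  map_add' c d := funext fun n => smul_add _ (c (n - 1)) (d (n - 1))
  map_smul' r c := funext fun n => smul_comm _ r (c (n - 1))

/-- Left multiplication by a quaternion on coordinate sequences. -/
noncomputable def lmul (q : ℍ[ℝ]) : Module.End ℝ (ℕ → ℍ[ℝ]) where
  toFun c n := q * c n
  map_add' c d := funext fun n => mul_add q (c n) (d n)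
  map_smul' r c := funext fun n => mul_smul_comm r q (c n)

/-- The generator `q a† - q̄ a` on coordinate sequences. -/
noncomputable def gen (q : ℍ[ℝ]) : Module.End ℝ (ℕ → ℍ[ℝ]) :=
  lmul q * raise - lmul (star q) * lower

theorem lower_apply (c : ℕ → ℍ[ℝ]) (n : ℕ) : lower c n = √((n : ℝ) + 1) • c (n + 1) := rfl

theorem raise_apply (c : ℕ → ℍ[ℝ]) (n : ℕ) : raise c n = √(n : ℝ) • c (n - 1) := rfl

theorem raise_apply_zero (c : ℕ → ℍ[ℝ]) : raise c 0 = 0 := by simp [raise_apply]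

theorem raise_apply_succ (c : ℕ → ℍ[ℝ]) (n : ℕ) :
    raise c (n + 1) = √((n : ℝ) + 1) • c n := by simp [raise_apply]

theorem lmul_apply (q : ℍ[ℝ]) (c : ℕ → ℍ[ℝ]) (n : ℕ) : lmul q c n = q * c n := rfl

theorem gen_apply (q : ℍ[ℝ]) (c : ℕ → ℍ[ℝ]) (n : ℕ) :
    gen q c n = q * raise c n - star q * lower c n := rfl

theorem lower_mul_raise : lower * raise = raise * lower + 1 := by
  ext1 c
  funext n
  change lower (raise c) n = raise (lower c) n + c n
  rw [lower_apply, raise_apply_succ, smul_smul, Real.mul_self_sqrt (by positivity), raise_apply]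
  cases n with
  | zero => simp
  | succ n =>
    rw [lower_apply, Nat.add_sub_cancel, smul_smul, Nat.cast_succ,
      Real.mul_self_sqrt (by positivity), add_smul, one_smul]

theorem lmul_mul (p q : ℍ[ℝ]) : lmul (p * q) = lmul p * lmul q := by
  ext1 c
  funext n
  exact mul_assoc p q (c n)

theorem lmul_sub (p q : ℍ[ℝ]) : lmul (p - q) = lmul p - lmul q := by
  ext1 c
  funext n
  exact sub_mul p q (c n)

theorem lmul_add (p q : ℍ[ℝ]) : lmul (p + q) = lmul p + lmul q := by
  ext1 c
  funext n
  exact add_mul p q (c n)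

theorem lmul_smul (r : ℝ) (q : ℍ[ℝ]) : lmul (r • q) = r • lmul q := by
  ext1 c
  funext n
  exact smul_mul_assoc r q (c n)

theorem lower_mul_lmul (q : ℍ[ℝ]) : lower * lmul q = lmul q * lower := by
  ext1 c
  funext n
  exact (mul_smul_comm √((n : ℝ) + 1) q (c (n + 1))).symm

theorem raise_mul_lmul (q : ℍ[ℝ]) : raise * lmul q = lmul q * raise := by
  ext1 c
  funext n
  exact (mul_smul_comm √(n : ℝ) q (c (n - 1))).symm

theorem gen_add_smul (p q : ℍ[ℝ]) (s : ℝ) : gen (q + s • p) = gen q + s • gen p := by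
  simp only [gen, star_add, Quaternion.star_smul, lmul_add, lmul_smul, add_mul, smul_mul_assoc,
    smul_sub]
  abel

theorem gen_zero : gen 0 = 0 := by
  ext1 c
  funext n
  simp [gen_apply]

theorem gen_neg (q : ℍ[ℝ]) : gen (-q) = -gen q := by
  ext1 c
  funext n
  change gen (-q) c n = -gen q c n
  simp only [gen_apply, star_neg, neg_mul]
  abel

/-- Only the `- q̄ a` part of the generator fails to commute with `a†`, and it contributes `- q̄
[a†, a] = q̄`. -/
theorem raise_mul_gen (q : ℍ[ℝ]) : raise * gen q = gen q * raise + lmul (star q) := by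
  have h : raise * gen q = lmul q * raise * raise - lmul (star q) * (raise * lower) := by
    rw [gen, mul_sub, ← mul_assoc, ← mul_assoc, raise_mul_lmul, raise_mul_lmul,
      mul_assoc _ raise lower]
  rw [h, gen, sub_mul, mul_assoc _ lower, lower_mul_raise]
  noncomm_ring

theorem lower_mul_gen (q : ℍ[ℝ]) : lower * gen q = gen q * lower + lmul q := by
  have h : lower * gen q = lmul q * (lower * raise) - lmul (star q) * lower * lower := by
    rw [gen, mul_sub, ← mul_assoc, ← mul_assoc, lower_mul_lmul, lower_mul_lmul,
      mul_assoc _ lower raise]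
  rw [h, gen, lower_mul_raise]
  simp only [sub_mul, mul_add, mul_one, mul_assoc]
  abel

theorem commute_lmul_gen {r q : ℍ[ℝ]} (h : Commute r q) (h' : Commute r (star q)) :
    Commute (lmul r) (gen q) := by
  have h1 : lmul r * lmul q = lmul q * lmul r := by rw [← lmul_mul, h.eq, lmul_mul]
  have h2 : lmul r * lmul (star q) = lmul (star q) * lmul r := by
    rw [← lmul_mul, h'.eq, lmul_mul]
  rw [commute_iff_eq, gen, mul_sub, sub_mul, ← mul_assoc, ← mul_assoc, h1, h2, mul_assoc,
    mul_assoc, ← raise_mul_lmul, ← lower_mul_lmul]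
  noncomm_ring

/-- The commutation hypotheses let `p` and `p̄` pass through `gen q`, so only the commutators of
`gen q` with `raise` and `lower` survive. Noncommuting quaternions would leave further quadratic
terms; this is what confines the calculus to a slice. -/
theorem gen_mul_gen {p q : ℍ[ℝ]} (h : Commute p q) (h' : Commute p (star q)) :
    gen p * gen q = gen q * gen p + lmul (p * star q - star p * q) := by
  have h1 : Commute (star p) (star q) := by
    rw [commute_iff_eq, ← star_mul, ← star_mul, h.eq]
  have h2 : Commute (star p) q := by
    have := congrArg star h'.eq
    rw [star_mul, star_mul, star_star] at this
    exact this.symm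
  have hp := commute_lmul_gen h h'
  have hp' := commute_lmul_gen h2 h1
  have hl : gen p * gen q = lmul p * (raise * gen q) - lmul (star p) * (lower * gen q) := by
    conv_lhs => rw [gen]
    simp only [sub_mul, mul_assoc]
  rw [hl, raise_mul_gen, lower_mul_gen, mul_add, mul_add, ← mul_assoc, ← mul_assoc, hp.eq, hp'.eq,
    ← lmul_mul, ← lmul_mul, lmul_sub]
  conv_rhs => rw [gen.eq_1 p]
  simp only [mul_sub, mul_assoc]
  abel

/-- Commutation of a power through a central commutator. -/
theorem mul_pow_of_commutator {R : Type*} [Ring R] {X A Y : R} (h : X * A = A * X + Y)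
    (hY : Commute Y A) (k : ℕ) : X * A ^ (k + 1) = A ^ (k + 1) * X + (k + 1 : ℕ) * (A ^ k * Y) := by
  induction k with
  | zero => simpa using h
  | succ k ih =>
    have h1 : Y * A ^ (k + 1) = A ^ (k + 1) * Y := (hY.pow_right (k + 1)).eq
    calc X * A ^ (k + 1 + 1) = (X * A ^ (k + 1)) * A := by rw [pow_succ A (k + 1), mul_assoc]
      _ = A ^ (k + 1) * (X * A) + (k + 1 : ℕ) * (A ^ k * (Y * A)) := by
        rw [ih]; noncomm_ring
      _ = A ^ (k + 1 + 1) * X + (k + 1 + 1 : ℕ) * (A ^ (k + 1) * Y) := by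
        rw [h, hY.eq, pow_succ A (k + 1), pow_succ A k]
        push_cast
        noncomm_ring

/-- Sequences vanishing from index `N` on. -/
def SupportedBelow (N : ℕ) (c : ℕ → ℍ[ℝ]) : Prop := ∀ n, N ≤ n → c n = 0

theorem SupportedBelow.mono {N M : ℕ} {c : ℕ → ℍ[ℝ]} (h : SupportedBelow N c) (hNM : N ≤ M) :
    SupportedBelow M c := fun n hn => h n (hNM.trans hn)

theorem SupportedBelow.add {N : ℕ} {c d : ℕ → ℍ[ℝ]} (hc : SupportedBelow N c)
    (hd : SupportedBelow N d) : SupportedBelow N (c + d) := fun n hn => by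
  rw [Pi.add_apply, hc n hn, hd n hn, add_zero]

theorem SupportedBelow.smul {N : ℕ} {c : ℕ → ℍ[ℝ]} (hc : SupportedBelow N c) (r : ℝ) :
    SupportedBelow N (r • c) := fun n hn => by
  rw [Pi.smul_apply, hc n hn, smul_zero]

theorem SupportedBelow.lower {N : ℕ} {c : ℕ → ℍ[ℝ]} (hc : SupportedBelow N c) :
    SupportedBelow N (lower c) := fun n hn => by
  rw [lower_apply, hc (n + 1) (by omega), smul_zero]

theorem SupportedBelow.raise {N : ℕ} {c : ℕ → ℍ[ℝ]} (hc : SupportedBelow N c) :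
    SupportedBelow (N + 1) (raise c) := fun n hn => by
  rw [raise_apply, hc (n - 1) (by omega), smul_zero]

theorem SupportedBelow.lmul {N : ℕ} {c : ℕ → ℍ[ℝ]} (hc : SupportedBelow N c) (q : ℍ[ℝ]) :
    SupportedBelow N (lmul q c) := fun n hn => by
  rw [lmul_apply, hc n hn, mul_zero]

theorem SupportedBelow.gen {N : ℕ} {c : ℕ → ℍ[ℝ]} (hc : SupportedBelow N c) (q : ℍ[ℝ]) :
    SupportedBelow (N + 1) (gen q c) := fun n hn => by
  rw [gen_apply, hc.raise n hn, hc.lower n (by omega), mul_zero, mul_zero, sub_zero]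

theorem SupportedBelow.gen_pow {N : ℕ} {c : ℕ → ℍ[ℝ]} (hc : SupportedBelow N c) (q : ℍ[ℝ])
    (k : ℕ) : SupportedBelow (N + k) ((QuaternionicFock.gen q ^ k) c) := by
  induction k with
  | zero => simpa using hc
  | succ k ih =>
    rw [pow_succ', Module.End.mul_apply]
    exact ih.gen q

/-- The ℓ¹ norm is convenient here: on sequences supported below `N`, both `raise` and `lower` use
weights at most `√N`, which produces the factor `2 ‖q‖ √N`. -/
theorem sum_norm_gen_le {N : ℕ} {c : ℕ → ℍ[ℝ]} (hc : SupportedBelow N c) (q : ℍ[ℝ]) :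
    ∑ n ∈ Finset.range (N + 1), ‖gen q c n‖ ≤
      2 * ‖q‖ * √(N : ℝ) * ∑ n ∈ Finset.range N, ‖c n‖ := by
  have h1 : ∑ n ∈ Finset.range (N + 1), ‖raise c n‖ ≤ √(N : ℝ) * ∑ n ∈ Finset.range N, ‖c n‖ := by
    rw [Finset.sum_range_succ', raise_apply_zero, norm_zero, add_zero, Finset.mul_sum]
    refine Finset.sum_le_sum fun n hn => ?_
    rw [raise_apply_succ, norm_smul, Real.norm_of_nonneg (Real.sqrt_nonneg _)]
    refine mul_le_mul_of_nonneg_right (Real.sqrt_le_sqrt ?_) (norm_nonneg _)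
    exact_mod_cast Finset.mem_range.1 hn
  have h2 : ∑ n ∈ Finset.range (N + 1), ‖lower c n‖ ≤ √(N : ℝ) * ∑ n ∈ Finset.range N, ‖c n‖ := by
    have h3 : ∀ n, ‖lower c n‖ ≤ √(N : ℝ) * ‖c (n + 1)‖ := by
      intro n
      rw [lower_apply, norm_smul, Real.norm_of_nonneg (Real.sqrt_nonneg _)]
      rcases lt_or_ge n N with hn | hn
      · refine mul_le_mul_of_nonneg_right (Real.sqrt_le_sqrt ?_) (norm_nonneg _)
        exact_mod_cast hn
      · rw [hc (n + 1) (by omega), norm_zero, mul_zero, mul_zero]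
    refine (Finset.sum_le_sum fun n _ => h3 n).trans ?_
    rw [← Finset.mul_sum]
    refine mul_le_mul_of_nonneg_left ?_ (Real.sqrt_nonneg _)
    have h4 : ∑ n ∈ Finset.range (N + 1 + 1), ‖c n‖ = ∑ n ∈ Finset.range N, ‖c n‖ := by
      rw [Finset.sum_range_succ, Finset.sum_range_succ, hc N le_rfl, hc (N + 1) (by omega),
        norm_zero, add_zero, add_zero]
    rw [← h4, Finset.sum_range_succ' _ (N + 1)]
    exact le_add_of_nonneg_right (norm_nonneg _)
  have h3 : ∀ n, ‖gen q c n‖ ≤ ‖q‖ * ‖raise c n‖ + ‖q‖ * ‖lower c n‖ := by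
    intro n
    rw [gen_apply]
    refine (norm_sub_le _ _).trans ?_
    rw [norm_mul, norm_mul, norm_star]
  refine (Finset.sum_le_sum fun n _ => h3 n).trans ?_
  rw [Finset.sum_add_distrib, ← Finset.mul_sum, ← Finset.mul_sum]
  have := mul_le_mul_of_nonneg_left h1 (norm_nonneg q)
  have := mul_le_mul_of_nonneg_left h2 (norm_nonneg q)
  linarith

/-- Each application enlarges the support by one, so the weights multiply to `√(N (N+1) ⋯ (N+k-1))`.
-/
theorem sum_norm_gen_pow_le {N : ℕ} {c : ℕ → ℍ[ℝ]} (hc : SupportedBelow N c) {q : ℍ[ℝ]} {R : ℝ}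
    (hq : ‖q‖ ≤ R) (k : ℕ) :
    ∑ n ∈ Finset.range (N + k), ‖(gen q ^ k) c n‖ ≤
      (2 * R) ^ k * √(N.ascFactorial k : ℝ) * ∑ n ∈ Finset.range N, ‖c n‖ := by
  have hR : 0 ≤ R := (norm_nonneg q).trans hq
  induction k with
  | zero => simp
  | succ k ih =>
    rw [pow_succ' (gen q), Module.End.mul_apply]
    refine (sum_norm_gen_le (hc.gen_pow q k) q).trans ?_
    have h0 : 0 ≤ ∑ n ∈ Finset.range (N + k), ‖(gen q ^ k) c n‖ :=
      Finset.sum_nonneg fun _ _ => norm_nonneg _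
    calc _ ≤ 2 * R * √((N + k : ℕ) : ℝ) *
          ((2 * R) ^ k * √(N.ascFactorial k : ℝ) * ∑ n ∈ Finset.range N, ‖c n‖) := by gcongr
      _ = _ := by
        rw [Nat.ascFactorial_succ, Nat.cast_mul, Real.sqrt_mul (Nat.cast_nonneg _), pow_succ]
        ring

theorem summable_pow_mul_sqrt_ascFactorial_div {R : ℝ} (hR : 0 ≤ R) (N : ℕ) :
    Summable fun k : ℕ => R ^ k * √(N.ascFactorial k : ℝ) / (k ! : ℝ) := by
  refine summable_of_ratio_norm_eventually_le (r := 1 / 2) (by norm_num) ?_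
  -- The ratio of consecutive terms is `R √(N+k) / (k+1)`. For `k ≥ N` and `k ≥ 8 R²` one has `R²
  -- (N+k) ≤ 2 R² k ≤ k²/4`, so the ratio is at most `1/2`.
  filter_upwards [eventually_ge_atTop N, eventually_ge_atTop ⌈8 * R ^ 2⌉₊] with k hk1 hk2
  have hk3 : 8 * R ^ 2 ≤ k := (Nat.le_ceil _).trans (by exact_mod_cast hk2)
  have hk4 : (N : ℝ) ≤ k := by exact_mod_cast hk1
  rw [Real.norm_of_nonneg (by positivity), Real.norm_of_nonneg (by positivity)]
  have h1 : R * √((N + k : ℕ) : ℝ) ≤ (k + 1) / 2 := by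
    refine abs_le_of_sq_le_sq' ?_ (by positivity) |>.2
    rw [mul_pow, Real.sq_sqrt (Nat.cast_nonneg _)]
    push_cast
    nlinarith [sq_nonneg R]
  rw [Nat.ascFactorial_succ, Nat.cast_mul, Real.sqrt_mul (Nat.cast_nonneg _), Nat.factorial_succ,
    Nat.cast_mul, pow_succ]
  have h2 : R ^ k * R * (√((N + k : ℕ) : ℝ) * √(N.ascFactorial k : ℝ)) /
      (((k + 1 : ℕ) : ℝ) * (k ! : ℝ))
      = R * √((N + k : ℕ) : ℝ) / (k + 1) * (R ^ k * √(N.ascFactorial k : ℝ) / (k ! : ℝ)) := by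
    push_cast
    field_simp
  rw [h2]
  refine mul_le_mul_of_nonneg_right ?_ (by positivity)
  rw [div_le_iff₀ (by positivity)]
  linarith

/-- The `k`-th term of the exponential series of `gen q`. -/
noncomputable def expTerm (q : ℍ[ℝ]) (k : ℕ) : Module.End ℝ (ℕ → ℍ[ℝ]) :=
  (k ! : ℝ)⁻¹ • gen q ^ k

theorem expTerm_zero (q : ℍ[ℝ]) : expTerm q 0 = 1 := by simp [expTerm]

theorem expTerm_succ (q : ℍ[ℝ]) (k : ℕ) :
    ((k + 1 : ℕ) : ℝ) • expTerm q (k + 1) = gen q * expTerm q k := by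
  rw [expTerm, expTerm, smul_smul, pow_succ', mul_smul_comm, Nat.factorial_succ]
  congr 1
  push_cast
  field_simp

/-- The degree `k + 1` part of `X e^A = e^A (X + Y)`; the factor `k + 1` from commuting `X` past
`A^(k+1)` turns `1/(k+1)!` into `1/k!`. -/
theorem mul_expTerm_succ {q : ℍ[ℝ]} {X Y : Module.End ℝ (ℕ → ℍ[ℝ])}
    (h : X * gen q = gen q * X + Y) (hY : Commute Y (gen q)) (k : ℕ) :
    X * expTerm q (k + 1) = expTerm q (k + 1) * X + expTerm q k * Y := by
  rw [expTerm, expTerm, mul_smul_comm, mul_pow_of_commutator h hY, smul_add, smul_mul_assoc,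
    smul_mul_assoc]
  congr 1
  rw [← nsmul_eq_mul, ← Nat.cast_smul_eq_nsmul ℝ, smul_smul, Nat.factorial_succ]
  congr 1
  push_cast
  field_simp

theorem SupportedBelow.expTerm {N : ℕ} {c : ℕ → ℍ[ℝ]} (hc : SupportedBelow N c) (q : ℍ[ℝ])
    (k : ℕ) : SupportedBelow (N + k) (expTerm q k c) :=
  (hc.gen_pow q k).smul _

/-- A bound for the terms of the exponential series on `SupportedBelow N`. -/
noncomputable def expBound (N : ℕ) (R : ℝ) (k : ℕ) : ℝ :=
  (2 * R) ^ k * √(N.ascFactorial k : ℝ) / (k ! : ℝ)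

theorem summable_expBound (N : ℕ) {R : ℝ} (hR : 0 ≤ R) : Summable (expBound N R) :=
  summable_pow_mul_sqrt_ascFactorial_div (by positivity) N

theorem sum_norm_expTerm_le {N : ℕ} {c : ℕ → ℍ[ℝ]} (hc : SupportedBelow N c) {q : ℍ[ℝ]} {R : ℝ}
    (hq : ‖q‖ ≤ R) (k : ℕ) :
    ∑ n ∈ Finset.range (N + k), ‖expTerm q k c n‖ ≤
      expBound N R k * ∑ n ∈ Finset.range N, ‖c n‖ := by
  have h : ∀ n, ‖expTerm q k c n‖ = (k ! : ℝ)⁻¹ * ‖(gen q ^ k) c n‖ := fun n => by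
    change ‖(k ! : ℝ)⁻¹ • (gen q ^ k) c n‖ = _
    rw [norm_smul, Real.norm_of_nonneg (by positivity)]
  simp only [h]
  rw [← Finset.mul_sum]
  refine (mul_le_mul_of_nonneg_left (sum_norm_gen_pow_le hc hq k) (by positivity)).trans_eq ?_
  rw [expBound]
  ring

end Sequences

/-! ### Finite vectors, formal skew-symmetry of the generator, truncations. -/

section Synthesis

variable {H : Type*} [NormedAddCommGroup H] [NormedSpace ℝ H] [RightInnerProductSpace H]
  (e : OrthonormalBasisSeq H)

theorem SupportedBelow.hasSum {N : ℕ} {c : ℕ → ℍ[ℝ]} (hc : SupportedBelow N c) :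
    HasSum (fun n => op (c n) • e.vec n) (∑ n ∈ Finset.range N, op (c n) • e.vec n) :=
  hasSum_sum_of_ne_finset_zero fun n hn => by
    rw [hc n (by simpa using hn), op_zero, zero_smul]

theorem SupportedBelow.synth_eq {N : ℕ} {c : ℕ → ℍ[ℝ]} (hc : SupportedBelow N c) :
    synth e c = ∑ n ∈ Finset.range N, op (c n) • e.vec n :=
  (hc.hasSum e).tsum_eq

theorem SupportedBelow.coords_synth {N : ℕ} {c : ℕ → ℍ[ℝ]} (hc : SupportedBelow N c) :
    coords e (synth e c) = c := by
  rw [hc.synth_eq]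
  exact coords_of_hasSum e (hc.hasSum e)

theorem SupportedBelow.norm_synth_le {N : ℕ} {c : ℕ → ℍ[ℝ]} (hc : SupportedBelow N c) :
    ‖synth e c‖ ≤ ∑ n ∈ Finset.range N, ‖c n‖ := by
  rw [hc.synth_eq]
  refine (norm_sum_le _ _).trans_eq (Finset.sum_congr rfl fun n _ => ?_)
  rw [norm_op_smul, norm_vec, one_mul]

theorem SupportedBelow.synth_eq_iff {N : ℕ} {c : ℕ → ℍ[ℝ]} (hc : SupportedBelow N c) {f : H} :
    synth e c = f ↔ c = coords e f := by
  rw [← (coords_injective e).eq_iff, hc.coords_synth]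

theorem SupportedBelow.qinner_synth {N : ℕ} {c : ℕ → ℍ[ℝ]} (hc : SupportedBelow N c) (f : H) :
    qinner f (synth e c) = ∑ n ∈ Finset.range N, star (coords e f n) * c n := by
  rw [hc.synth_eq, ← qinnerCLM_apply, map_sum]
  refine Finset.sum_congr rfl fun n _ => ?_
  rw [qinnerCLM_apply, qinner_smul_right, coords_apply, star_qinner]

/-- `raise` and `lower` are transposes of each other with real weights, and conjugation exchanges
`q` and `q̄`. Only `c` needs finite support: summing up to `N` inclusive makes the boundary terms of
both index shifts vanish, whatever `u` is. -/
theorem sum_star_gen_mul {N : ℕ} {c : ℕ → ℍ[ℝ]} (hc : SupportedBelow N c) (q : ℍ[ℝ])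
    (u : ℕ → ℍ[ℝ]) :
    ∑ n ∈ Finset.range (N + 1), star (gen q u n) * c n =
      -∑ n ∈ Finset.range (N + 1), star (u n) * gen q c n := by
  set v : ℕ → ℍ[ℝ] := fun n => star (u n) with hv
  have h1 : ∀ r : ℍ[ℝ], ∑ n ∈ Finset.range (N + 1), raise v n * r * c n =
      ∑ n ∈ Finset.range (N + 1), v n * r * lower c n := by
    intro r
    rw [Finset.sum_range_succ', Finset.sum_range_succ _ N, hc.lower N le_rfl, raise_apply_zero,
      zero_mul, zero_mul, mul_zero]
    congr 1
    refine Finset.sum_congr rfl fun n _ => ?_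
    rw [raise_apply_succ, lower_apply, smul_mul_assoc, smul_mul_assoc, mul_smul_comm]
  have h2 : ∀ r : ℍ[ℝ], ∑ n ∈ Finset.range (N + 1), lower v n * r * c n =
      ∑ n ∈ Finset.range (N + 1), v n * r * raise c n := by
    intro r
    rw [Finset.sum_range_succ, Finset.sum_range_succ' _ N, hc N le_rfl, raise_apply_zero,
      mul_zero, mul_zero]
    congr 1
    refine Finset.sum_congr rfl fun n _ => ?_
    rw [raise_apply_succ, lower_apply, smul_mul_assoc, smul_mul_assoc, mul_smul_comm]
  have h3 : ∀ n, star (gen q u n) * c n =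
      raise v n * star q * c n - lower v n * q * c n := by
    intro n
    have hr : star (raise u n) = raise v n := Quaternion.star_smul _ _
    have hl : star (lower u n) = lower v n := Quaternion.star_smul _ _
    rw [gen_apply, star_sub, star_mul, star_mul, star_star, hr, hl, sub_mul]
  have h4 : ∀ n, star (u n) * gen q c n =
      v n * q * raise c n - v n * star q * lower c n := by
    intro n
    rw [gen_apply, mul_sub, mul_assoc, mul_assoc]
  simp only [h3, h4, Finset.sum_sub_distrib, h1, h2]
  abel

theorem norm_synth_expTerm_le {N : ℕ} {c : ℕ → ℍ[ℝ]} (hc : SupportedBelow N c)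
    {q : ℍ[ℝ]} {R : ℝ} (hq : ‖q‖ ≤ R) (k : ℕ) :
    ‖synth e (expTerm q k c)‖ ≤ expBound N R k * ∑ n ∈ Finset.range N, ‖c n‖ :=
  ((hc.expTerm q k).norm_synth_le e).trans (sum_norm_expTerm_le hc hq k)

/-- Truncation of a sequence to the indices below `N`. -/
noncomputable def trunc (N : ℕ) : Module.End ℝ (ℕ → ℍ[ℝ]) where
  toFun c n := if n < N then c n else 0
  map_add' c d := funext fun n => by
    change (if n < N then c n + d n else 0) = (if n < N then c n else 0) + if n < N then d n else 0
    split_ifs <;> simp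
  map_smul' r c := funext fun n => by
    change (if n < N then r • c n else 0) = r • if n < N then c n else 0
    split_ifs <;> simp

theorem trunc_apply (N : ℕ) (c : ℕ → ℍ[ℝ]) (n : ℕ) :
    trunc N c n = if n < N then c n else 0 := rfl

theorem supportedBelow_trunc (N : ℕ) (c : ℕ → ℍ[ℝ]) : SupportedBelow N (trunc N c) :=
  fun n hn => by rw [trunc_apply, if_neg (by omega)]

theorem raise_trunc (N : ℕ) (c : ℕ → ℍ[ℝ]) : raise (trunc N c) = trunc (N + 1) (raise c) := by
  funext n
  cases n with
  | zero => simp [trunc_apply, raise_apply]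
  | succ n => simp [trunc_apply, raise_apply_succ]

theorem lower_trunc (N : ℕ) (c : ℕ → ℍ[ℝ]) : lower (trunc (N + 1) c) = trunc N (lower c) := by
  funext n
  simp [trunc_apply, lower_apply]

theorem lmul_trunc (q : ℍ[ℝ]) (N : ℕ) (c : ℕ → ℍ[ℝ]) :
    lmul q (trunc N c) = trunc N (lmul q c) := by
  funext n
  simp [trunc_apply, lmul_apply]

theorem SupportedBelow.trunc_eq {N M : ℕ} {c : ℕ → ℍ[ℝ]} (hc : SupportedBelow N c)
    (h : N ≤ M) : trunc M c = c := by
  funext n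
  rw [trunc_apply]
  split_ifs with hn
  · rfl
  · rw [hc n (by omega)]

/-- The exponential series of `gen q` applied to a finitely supported sequence. -/
noncomputable def expVec (q : ℍ[ℝ]) (c : ℕ → ℍ[ℝ]) : H := ∑' k, synth e (expTerm q k c)

theorem expVec_zero_right (q : ℍ[ℝ]) : expVec e q 0 = 0 := by
  simp [expVec, synth]

end Synthesis

/-! ### The exponential on finite vectors and its intertwining relations. -/

section Exponential

variable {H : Type*} [NormedAddCommGroup H] [NormedSpace ℝ H] [RightInnerProductSpace H]
  [CompleteSpace H] (e : OrthonormalBasisSeq H)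

theorem coords_leftMul' (q : ℍ[ℝ]) (f : H) : coords e (leftMul e q f) = lmul q (coords e f) :=
  funext (coords_leftMul e q f)

theorem tendsto_synth_trunc (f : H) :
    Tendsto (fun N => synth e (trunc N (coords e f))) atTop (𝓝 f) := by
  refine (hasSum_coords e f).tendsto_sum_nat.congr fun N => ?_
  rw [(supportedBelow_trunc N _).synth_eq]
  refine Finset.sum_congr rfl fun n hn => ?_
  rw [trunc_apply, if_pos (Finset.mem_range.1 hn)]

theorem gen_coords {f f₁ f₂ : H} (h₁ : coords e f₁ = lower (coords e f))
    (h₂ : coords e f₂ = raise (coords e f)) (q : ℍ[ℝ]) :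
    gen q (coords e f) = coords e (leftMul e q f₂ - leftMul e (star q) f₁) := by
  rw [map_sub, coords_leftMul', coords_leftMul', h₁, h₂]
  rfl

/-- Finite vectors form a core for the generator: `raise` sends the truncation at `N + 1` to that at
`N + 2` of the image, `lower` to that at `N`, so both parts converge. -/
theorem tendsto_synth_gen_trunc {f f₁ f₂ : H} (h₁ : coords e f₁ = lower (coords e f))
    (h₂ : coords e f₂ = raise (coords e f)) (q : ℍ[ℝ]) :
    Tendsto (fun N => synth e (gen q (trunc (N + 1) (coords e f)))) atTop
      (𝓝 (leftMul e q f₂ - leftMul e (star q) f₁)) := by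
  have ha := (tendsto_synth_trunc e (leftMul e q f₂)).comp (tendsto_add_atTop_nat 2)
  have hb := tendsto_synth_trunc e (leftMul e (star q) f₁)
  refine (ha.sub hb).congr fun N => ?_
  refine (((SupportedBelow.synth_eq_iff e ((supportedBelow_trunc _ _).gen q)).2 ?_)).symm
  rw [map_sub, Function.comp_apply, (supportedBelow_trunc _ _).coords_synth,
    (supportedBelow_trunc _ _).coords_synth, coords_leftMul', coords_leftMul', h₁, h₂,
    ← lmul_trunc, ← lmul_trunc, ← raise_trunc, ← lower_trunc]
  rfl

/-- The finite identity applies to `f` against its truncations; the limit is legitimate because the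
generator applied to the truncations converges in norm. -/
theorem qinner_gen_skew {f f₁ f₂ g : H} (h₁ : coords e f₁ = lower (coords e f))
    (h₂ : coords e f₂ = raise (coords e f)) {q : ℍ[ℝ]} (hg : coords e g = gen q (coords e f)) :
    qinner f g = -qinner g f := by
  have hg' : g = leftMul e q f₂ - leftMul e (star q) f₁ :=
    coords_injective e (hg.trans (gen_coords e h₁ h₂ q))
  have ha : Tendsto (fun N => qinner f (synth e (gen q (trunc (N + 1) (coords e f))))) atTop
      (𝓝 (qinner f g)) := by
    rw [hg']
    exact ((qinnerCLM f).continuous.tendsto _).comp (tendsto_synth_gen_trunc e h₁ h₂ q)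
  have hb : Tendsto (fun N => -qinner g (synth e (trunc (N + 1) (coords e f)))) atTop
      (𝓝 (-qinner g f)) :=
    (((qinnerCLM g).continuous.tendsto _).comp
      ((tendsto_synth_trunc e f).comp (tendsto_add_atTop_nat 1))).neg
  refine tendsto_nhds_unique ha (hb.congr fun N => ?_)
  have hs := supportedBelow_trunc (N + 1) (coords e f)
  rw [(hs.gen q).qinner_synth, (hs.mono (Nat.le_succ _)).qinner_synth, hg, sum_star_gen_mul hs]
  exact neg_neg _

variable {N : ℕ} {c : ℕ → ℍ[ℝ]}

theorem hasSum_expVec (hc : SupportedBelow N c) (q : ℍ[ℝ]) :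
    HasSum (fun k => synth e (expTerm q k c)) (expVec e q c) :=
  (Summable.of_norm_bounded ((summable_expBound N (norm_nonneg q)).mul_right _)
    (norm_synth_expTerm_le e hc le_rfl)).hasSum

theorem hasSum_coords_expVec (hc : SupportedBelow N c) (q : ℍ[ℝ]) :
    HasSum (fun k => expTerm q k c) (coords e (expVec e q c)) := by
  rw [Pi.hasSum]
  intro n
  refine ((qinnerCLM (e.vec n)).hasSum (hasSum_expVec e hc q)).congr_fun fun k => ?_
  exact (congrFun ((hc.expTerm q k).coords_synth e) n).symm

/-- Prepending a zero aligns the degrees of the commutator terms, so that series identities can be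
checked term by term. -/
theorem hasSum_shift {E : Type*} [AddCommGroup E] [TopologicalSpace E] [IsTopologicalAddGroup E]
    {f : ℕ → E} {a : E} (h : HasSum f a) :
    HasSum (fun k : ℕ => Nat.casesOn (motive := fun _ => E) k 0 f) a := by
  have := (hasSum_nat_add_iff (f := fun k : ℕ => Nat.casesOn (motive := fun _ => E) k 0 f) 1).1 h
  simpa using this

/-- Summing `X e^A = e^A (X + Y)` takes place in the product topology, where each coordinate of `X`
depends continuously on the sequence; unboundedness of `X` in norm is therefore harmless. -/
theorem map_coords_expVec {M M' : ℕ} {q : ℍ[ℝ]} {X Y : Module.End ℝ (ℕ → ℍ[ℝ])}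
    (h : X * gen q = gen q * X + Y) (hY : Commute Y (gen q)) (hX : Continuous X)
    (hc : SupportedBelow N c) (hXc : SupportedBelow M (X c)) (hYc : SupportedBelow M' (Y c)) :
    X (coords e (expVec e q c)) = coords e (expVec e q (X c)) + coords e (expVec e q (Y c)) := by
  have h1 : HasSum (fun k => X (expTerm q k c)) (X (coords e (expVec e q c))) :=
    (hasSum_coords_expVec e hc q).map X hX
  refine h1.unique (((hasSum_coords_expVec e hXc q).add
    (hasSum_shift (hasSum_coords_expVec e hYc q))).congr_fun fun k => ?_)
  cases k with
  | zero => simp [expTerm_zero]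
  | succ k => exact LinearMap.congr_fun (mul_expTerm_succ h hY k) c

theorem continuous_raise : Continuous raise :=
  continuous_pi fun n => (continuous_apply (n - 1)).const_smul √(n : ℝ)

theorem continuous_lower : Continuous lower :=
  continuous_pi fun n => (continuous_apply (n + 1)).const_smul √((n : ℝ) + 1)

theorem continuous_lmul (q : ℍ[ℝ]) : Continuous (lmul q) :=
  continuous_pi fun n => (continuous_apply n).const_mul _

theorem continuous_gen (q : ℍ[ℝ]) : Continuous (gen q) :=
  ((continuous_lmul q).comp continuous_raise).sub ((continuous_lmul _).comp continuous_lower)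

theorem coords_raise_expVec (hc : SupportedBelow N c) (q : ℍ[ℝ]) :
    raise (coords e (expVec e q c)) =
      coords e (expVec e q (raise c)) + coords e (expVec e q (lmul (star q) c)) :=
  map_coords_expVec e (raise_mul_gen q)
    (commute_lmul_gen (star_comm_self' q) (Commute.refl (star q))) continuous_raise
    hc hc.raise (hc.lmul _)

theorem coords_lower_expVec (hc : SupportedBelow N c) (q : ℍ[ℝ]) :
    lower (coords e (expVec e q c)) =
      coords e (expVec e q (lower c)) + coords e (expVec e q (lmul q c)) :=
  map_coords_expVec e (lower_mul_gen q)
    (commute_lmul_gen (Commute.refl q) (star_comm_self' q).symm) continuous_lower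
    hc hc.lower (hc.lmul _)

theorem map_coords_expVec_of_commute {M : ℕ} {q : ℍ[ℝ]} {X : Module.End ℝ (ℕ → ℍ[ℝ])}
    (h : Commute X (gen q)) (hX : Continuous X)
    (hc : SupportedBelow N c) (hXc : SupportedBelow M (X c)) :
    X (coords e (expVec e q c)) = coords e (expVec e q (X c)) := by
  have h0 : SupportedBelow 0 ((0 : Module.End ℝ (ℕ → ℍ[ℝ])) c) := fun _ _ => rfl
  rw [map_coords_expVec e (Y := 0) (by rw [h.eq, add_zero]) (Commute.zero_left _) hX hc hXc h0,
    LinearMap.zero_apply, expVec_zero_right, map_zero, add_zero]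

theorem expVec_lmul {r q : ℍ[ℝ]} (h : Commute r q) (h' : Commute r (star q))
    (hc : SupportedBelow N c) : expVec e q (lmul r c) = leftMul e r (expVec e q c) :=
  coords_injective e (by
    rw [coords_leftMul', map_coords_expVec_of_commute e (commute_lmul_gen h h')
      (continuous_lmul r) hc (hc.lmul r)])

theorem raise_coords_expVec (hc : SupportedBelow N c) (q : ℍ[ℝ]) :
    raise (coords e (expVec e q c)) =
      coords e (expVec e q (raise c) + leftMul e (star q) (expVec e q c)) := by
  rw [coords_raise_expVec e hc, map_add,
    expVec_lmul e (star_comm_self' q) (Commute.refl (star q)) hc]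

theorem lower_coords_expVec (hc : SupportedBelow N c) (q : ℍ[ℝ]) :
    lower (coords e (expVec e q c)) =
      coords e (expVec e q (lower c) + leftMul e q (expVec e q c)) := by
  rw [coords_lower_expVec e hc, map_add,
    expVec_lmul e (Commute.refl q) (star_comm_self' q).symm hc]

theorem expVec_zero_left (hc : SupportedBelow N c) : expVec e 0 c = synth e c := by
  refine (hasSum_expVec e hc 0).unique ?_
  convert hasSum_ite_eq 0 (synth e c) using 2 with k
  cases k with
  | zero => simp [expTerm_zero]
  | succ k => simp [expTerm, gen_zero, synth]

theorem expVec_add {d : ℕ → ℍ[ℝ]} {M : ℕ} (hc : SupportedBelow N c) (hd : SupportedBelow M d)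
    (q : ℍ[ℝ]) : expVec e q (c + d) = expVec e q c + expVec e q d := by
  have hc' := hc.mono (le_max_left N M)
  have hd' := hd.mono (le_max_right N M)
  refine coords_injective e ((hasSum_coords_expVec e (hc'.add hd') q).unique ?_)
  rw [map_add]
  refine ((hasSum_coords_expVec e hc q).add (hasSum_coords_expVec e hd q)).congr_fun fun k => ?_
  exact map_add _ _ _

theorem expVec_smul (hc : SupportedBelow N c) (q : ℍ[ℝ]) (r : ℝ) :
    expVec e q (r • c) = r • expVec e q c := by
  refine coords_injective e ((hasSum_coords_expVec e (hc.smul r) q).unique ?_)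
  rw [map_smul]
  refine ((hasSum_coords_expVec e hc q).const_smul r).congr_fun fun k => ?_
  exact map_smul _ _ _

end Exponential

/-! ### Directional derivative of the exponential on finite vectors, and norm preservation. -/

section Derivative

/-- The commutator `[gen p, gen q]` for commuting `p`, `q` is left multiplication by this. -/
noncomputable def symplectic (p q : ℍ[ℝ]) : ℍ[ℝ] := p * star q - star p * q

/-- As `p` commutes with `p̄`, the central term is constant along the line `q + s p`. -/
theorem symplectic_add_smul (p q : ℍ[ℝ]) (s : ℝ) : symplectic p (q + s • p) = symplectic p q := by
  have h : p * star p = star p * p := (star_comm_self' p).symm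
  rw [symplectic, symplectic, star_add, Quaternion.star_smul, mul_add, mul_add, mul_smul_comm,
    mul_smul_comm, h]
  abel

theorem commute_add_smul {p q : ℍ[ℝ]} (h : Commute p q) (s : ℝ) : Commute p (q + s • p) :=
  h.add_right ((Commute.refl p).smul_right s)

theorem commute_star_add_smul {p q : ℍ[ℝ]} (h : Commute p (star q)) (s : ℝ) :
    Commute p (star (q + s • p)) := by
  rw [star_add, Quaternion.star_smul]
  have hp : Commute p (star p) := (star_comm_self' p).symm
  exact h.add_right (hp.smul_right s)

theorem commute_symplectic {p q : ℍ[ℝ]} (h : Commute p q) (h' : Commute p (star q)) :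
    Commute (symplectic p q) q ∧ Commute (symplectic p q) (star q) := by
  have h1 : Commute (star p) (star q) := by
    rw [commute_iff_eq, ← star_mul, ← star_mul, h.eq]
  have h2 : Commute (star p) q := by
    have := congrArg star h'.eq
    rw [star_mul, star_mul, star_star] at this
    exact this.symm
  exact ⟨(h.mul_left (star_comm_self' q)).sub_left (h2.mul_left (Commute.refl q)),
    (h'.mul_left (Commute.refl _)).sub_left (h1.mul_left (star_comm_self' q).symm)⟩

/-- The derivative of the `k`-th exponential term along the direction `p`. -/
noncomputable def expTermDeriv (p q : ℍ[ℝ]) : ℕ → Module.End ℝ (ℕ → ℍ[ℝ])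
  | 0 => 0
  | 1 => gen p
  | k + 2 => expTerm q (k + 1) * gen p + (1 / 2 : ℝ) • (expTerm q k * lmul (symplectic p q))

/-- This is the product rule applied to `(k+1) E_{k+1} = A E_k`. The closed form satisfies it
because moving `gen p` past `E_k` costs `E_{k-1} Y` with `Y` central, which also explains the
coefficient `1/2`. -/
theorem expTermDeriv_succ {p q : ℍ[ℝ]} (h : Commute p q) (h' : Commute p (star q)) (k : ℕ) :
    ((k + 1 : ℕ) : ℝ) • expTermDeriv p q (k + 1) =
      gen q * expTermDeriv p q k + gen p * expTerm q k := by
  have hY : Commute (lmul (symplectic p q)) (gen q) :=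
    commute_lmul_gen (commute_symplectic h h').1 (commute_symplectic h h').2
  have hc := mul_expTerm_succ (gen_mul_gen h h') hY
  change ∀ k, gen p * expTerm q (k + 1) =
    expTerm q (k + 1) * gen p + expTerm q k * lmul (symplectic p q) at hc
  match k with
  | 0 => simp [expTermDeriv, expTerm_zero]
  | 1 =>
    have h1 := expTerm_succ q 0
    rw [hc]
    simp only [expTermDeriv, expTerm_zero, one_mul, mul_one, zero_add, Nat.cast_one, one_smul]
      at h1 ⊢
    rw [h1, smul_add, smul_smul]
    norm_num
    rw [two_smul]
    abel
  | k + 2 =>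
    have h1 := expTerm_succ q (k + 1)
    have h2 := expTerm_succ q k
    rw [hc]
    simp only [expTermDeriv, mul_add, ← mul_assoc, mul_smul_comm, ← h1, ← h2, smul_add,
      smul_mul_assoc, smul_smul]
    push_cast
    module

theorem SupportedBelow.expTermDeriv {N : ℕ} {c : ℕ → ℍ[ℝ]} (hc : SupportedBelow N c)
    (p q : ℍ[ℝ]) (k : ℕ) : SupportedBelow (N + k) (expTermDeriv p q k c) := by
  match k with
  | 0 => exact fun n _ => rfl
  | 1 => exact hc.gen p
  | k + 2 =>
    exact (((hc.gen p).expTerm q (k + 1)).mono (by omega)).add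
      ((((hc.lmul _).expTerm q k).smul (1 / 2)).mono (by omega))

theorem hasDerivAt_gen_apply {u : ℝ → ℕ → ℍ[ℝ]} {u' : ℕ → ℍ[ℝ]} {s : ℝ}
    (h : ∀ n, HasDerivAt (fun s => u s n) (u' n) s) (q : ℍ[ℝ]) (n : ℕ) :
    HasDerivAt (fun s => gen q (u s) n) (gen q u' n) s := by
  have h1 : HasDerivAt (fun s => √(n : ℝ) • u s (n - 1)) (√(n : ℝ) • u' (n - 1)) s :=
    (h (n - 1)).const_smul √(n : ℝ)
  have h2 : HasDerivAt (fun s => √((n : ℝ) + 1) • u s (n + 1)) (√((n : ℝ) + 1) • u' (n + 1)) s :=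
    (h (n + 1)).const_smul √((n : ℝ) + 1)
  exact (h1.const_mul q).sub (h2.const_mul (star q))

theorem hasDerivAt_expTerm {p q : ℍ[ℝ]} (h : Commute p q) (h' : Commute p (star q))
    (c : ℕ → ℍ[ℝ]) (k : ℕ) (s : ℝ) (n : ℕ) :
    HasDerivAt (fun s : ℝ => expTerm (q + s • p) k c n)
      (expTermDeriv p (q + s • p) k c n) s := by
  induction k generalizing n with
  | zero =>
    simp only [expTerm_zero]
    exact hasDerivAt_const s (c n)
  | succ k ih =>
    have hk : ((k + 1 : ℕ) : ℝ) ≠ 0 := by positivity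
    have h1 : ∀ s : ℝ, expTerm (q + s • p) (k + 1) c n = ((k + 1 : ℕ) : ℝ)⁻¹ •
        (gen q (expTerm (q + s • p) k c) n + s • gen p (expTerm (q + s • p) k c) n) := by
      intro s
      rw [eq_inv_smul_iff₀ hk]
      have := congrFun (LinearMap.congr_fun (expTerm_succ (q + s • p) k) c) n
      rw [gen_add_smul] at this
      exact this
    have h2 : expTermDeriv p (q + s • p) (k + 1) c n = ((k + 1 : ℕ) : ℝ)⁻¹ •
        (gen q (expTermDeriv p (q + s • p) k c) n +
          (s • gen p (expTermDeriv p (q + s • p) k c) n +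
            (1 : ℝ) • gen p (expTerm (q + s • p) k c) n)) := by
      rw [eq_inv_smul_iff₀ hk]
      have := congrFun (LinearMap.congr_fun (expTermDeriv_succ (commute_add_smul h s)
        (commute_star_add_smul h' s) k) c) n
      rw [gen_add_smul] at this
      refine this.trans ?_
      rw [one_smul, ← add_assoc]
      rfl
    simp only [h1]
    rw [h2]
    exact ((hasDerivAt_gen_apply ih q n).add
      ((hasDerivAt_id s).smul (hasDerivAt_gen_apply ih p n))).const_smul ((k + 1 : ℕ) : ℝ)⁻¹

variable {H : Type*} [NormedAddCommGroup H] [NormedSpace ℝ H] [RightInnerProductSpace H]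
  (e : OrthonormalBasisSeq H) {N : ℕ} {c : ℕ → ℍ[ℝ]}

theorem hasDerivAt_synth_expTerm {p q : ℍ[ℝ]} (h : Commute p q) (h' : Commute p (star q))
    (hc : SupportedBelow N c) (k : ℕ) (s : ℝ) :
    HasDerivAt (fun s : ℝ => synth e (expTerm (q + s • p) k c))
      (synth e (expTermDeriv p (q + s • p) k c)) s := by
  have h1 : ∀ s : ℝ, synth e (expTerm (q + s • p) k c) =
      ∑ n ∈ Finset.range (N + k), ket (e.vec n) (expTerm (q + s • p) k c n) :=
    fun s => (hc.expTerm _ k).synth_eq e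
  simp only [h1]
  rw [(hc.expTermDeriv p _ k).synth_eq e]
  refine HasDerivAt.fun_sum fun n _ => ?_
  exact (ket (e.vec n)).hasFDerivAt.comp_hasDerivAt s (hasDerivAt_expTerm h h' c k s n)

theorem SupportedBelow.synth_add {d : ℕ → ℍ[ℝ]} (hc : SupportedBelow N c)
    (hd : SupportedBelow N d) : synth e (c + d) = synth e c + synth e d := by
  rw [(hc.add hd).synth_eq_iff, map_add, hc.coords_synth, hd.coords_synth]

theorem SupportedBelow.synth_smul (hc : SupportedBelow N c) (r : ℝ) :
    synth e (r • c) = r • synth e c := by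
  rw [(hc.smul r).synth_eq_iff, map_smul, hc.coords_synth]

theorem synth_expTermDeriv {p q : ℍ[ℝ]} (hc : SupportedBelow N c) (k : ℕ) :
    synth e (expTermDeriv p q (k + 2) c) = synth e (expTerm q (k + 1) (gen p c)) +
      (1 / 2 : ℝ) • synth e (expTerm q k (lmul (symplectic p q) c)) := by
  have h1 := ((hc.gen p).expTerm q (k + 1))
  have h2 := ((hc.lmul (symplectic p q)).expTerm q k)
  have h3 : N + k ≤ N + 1 + (k + 1) := by omega
  rw [← h2.synth_smul, ← h1.synth_add e ((h2.smul _).mono h3)]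
  rfl

/-- A majorant independent of the point in the ball of radius `R`. The truncated subtractions matter
only for `k = 0, 1`, where the superfluous terms are nonnegative. -/
theorem norm_synth_expTermDeriv_le {p q : ℍ[ℝ]} (hc : SupportedBelow N c) {R : ℝ} (hq : ‖q‖ ≤ R)
    (k : ℕ) : ‖synth e (expTermDeriv p q k c)‖ ≤
      expBound (N + 1) R (k - 1) * (∑ n ∈ Finset.range (N + 1), ‖gen p c n‖) +
        expBound N R (k - 2) * (∑ n ∈ Finset.range N, ‖lmul (symplectic p q) c n‖) := by
  have hR : 0 ≤ R := (norm_nonneg q).trans hq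
  have hB : ∀ N k, 0 ≤ expBound N R k := fun N k => by unfold expBound; positivity
  have hS : 0 ≤ ∑ n ∈ Finset.range N, ‖lmul (symplectic p q) c n‖ :=
    Finset.sum_nonneg fun _ _ => norm_nonneg _
  have hS' : 0 ≤ ∑ n ∈ Finset.range (N + 1), ‖gen p c n‖ :=
    Finset.sum_nonneg fun _ _ => norm_nonneg _
  match k with
  | 0 =>
    have : synth e (expTermDeriv p q 0 c) = 0 := by simp [synth, expTermDeriv]
    rw [this, norm_zero]
    exact add_nonneg (mul_nonneg (hB _ _) hS') (mul_nonneg (hB _ _) hS)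
  | 1 =>
    have h1 := norm_synth_expTerm_le e (hc.gen p) hq 0
    rw [expTerm_zero] at h1
    exact h1.trans (le_add_of_nonneg_right (mul_nonneg (hB _ _) hS))
  | k + 2 =>
    rw [synth_expTermDeriv e hc]
    refine (norm_add_le _ _).trans (add_le_add (norm_synth_expTerm_le e (hc.gen p) hq (k + 1)) ?_)
    rw [norm_smul]
    refine le_trans ?_ (norm_synth_expTerm_le e (hc.lmul (symplectic p q)) hq k)
    refine mul_le_of_le_one_left (norm_nonneg _) ?_
    norm_num

variable [CompleteSpace H]

theorem hasSum_synth_expTermDeriv (p q : ℍ[ℝ]) (hc : SupportedBelow N c) :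
    HasSum (fun k => synth e (expTermDeriv p q k c))
      (expVec e q (gen p c) + (1 / 2 : ℝ) • expVec e q (lmul (symplectic p q) c)) := by
  have h1 := hasSum_shift (hasSum_expVec e (hc.gen p) q)
  have h2 := hasSum_shift (hasSum_shift
    ((hasSum_expVec e (hc.lmul (symplectic p q)) q).const_smul (1 / 2 : ℝ)))
  refine (h1.add h2).congr_fun fun k => ?_
  match k with
  | 0 => simp [synth, expTermDeriv]
  | 1 => simp [expTermDeriv, expTerm_zero]
  | k + 2 => exact synth_expTermDeriv e hc k

theorem hasDerivAt_expVec {p q : ℍ[ℝ]} (h : Commute p q) (h' : Commute p (star q))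
    (hc : SupportedBelow N c) (s : ℝ) :
    HasDerivAt (fun s : ℝ => expVec e (q + s • p) c)
      (expVec e (q + s • p) (gen p c) +
        (1 / 2 : ℝ) • expVec e (q + s • p) (lmul (symplectic p q) c)) s := by
  -- `R` bounds `‖q + t p‖` for all `t` within distance one of `s`, so one summable majorant serves
  -- for termwise differentiation near `s`.
  set R : ℝ := ‖q‖ + (|s| + 1) * ‖p‖
  have hR : 0 ≤ R := by positivity
  have hball : ∀ t ∈ Metric.ball s 1, ‖q + t • p‖ ≤ R := by
    intro t ht
    refine (norm_add_le _ _).trans (add_le_add le_rfl ?_)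
    rw [norm_smul]
    refine mul_le_mul_of_nonneg_right ?_ (norm_nonneg _)
    rw [Metric.mem_ball, Real.dist_eq] at ht
    rw [Real.norm_eq_abs]
    have := abs_sub_abs_le_abs_sub t s
    linarith
  have hu : Summable fun k : ℕ =>
      expBound (N + 1) R (k - 1) * (∑ n ∈ Finset.range (N + 1), ‖gen p c n‖) +
        expBound N R (k - 2) * (∑ n ∈ Finset.range N, ‖lmul (symplectic p q) c n‖) := by
    refine Summable.add (Summable.mul_right _ ?_) (Summable.mul_right _ ?_)
    · exact (summable_nat_add_iff 1).1 (summable_expBound (N + 1) hR)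
    · exact (summable_nat_add_iff 2).1 (summable_expBound N hR)
  have key := hasDerivAt_tsum_of_isPreconnected hu Metric.isOpen_ball
    (convex_ball s 1).isPreconnected
    (fun k t _ => hasDerivAt_synth_expTerm e h h' hc k t)
    (fun k t ht => by
      have := norm_synth_expTermDeriv_le e (p := p) hc (hball t ht) k
      rwa [symplectic_add_smul] at this)
    (Metric.mem_ball_self one_pos) (hasSum_expVec e hc (q + s • p)).summable
    (Metric.mem_ball_self one_pos)
  rw [(hasSum_synth_expTermDeriv e p (q + s • p) hc).tsum_eq, symplectic_add_smul] at key
  exact key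

/-- Along `s ↦ e^{sA} c` the squared norm has derivative `2 Re ⟨e^{sA} c | A e^{sA} c⟩`, which
vanishes by skew-symmetry; compare `s = 1` with `s = 0`. -/
theorem norm_expVec (hc : SupportedBelow N c) (q : ℍ[ℝ]) : ‖expVec e q c‖ = ‖synth e c‖ := by
  let _ : InnerProductSpace ℝ H := realInnerProductSpace
  have hd : ∀ s : ℝ, HasDerivAt (fun s : ℝ => expVec e (s • q) c)
      (expVec e (s • q) (gen q c)) s := by
    intro s
    have h0 : lmul (symplectic q 0) c = 0 := by
      funext n
      simp [lmul_apply, symplectic]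
    have h1 := hasDerivAt_expVec e (p := q) (q := 0) (Commute.zero_right q)
      (by rw [star_zero]; exact Commute.zero_right q) hc s
    simpa only [zero_add, h0, expVec_zero_right, smul_zero, add_zero] using h1
  have hskew : ∀ s : ℝ, inner ℝ (expVec e (s • q) c) (expVec e (s • q) (gen q c)) = 0 := by
    intro s
    have hcomm : Commute (gen q) (gen (s • q)) := by
      have := gen_add_smul q 0 s
      rw [zero_add, gen_zero, zero_add] at this
      rw [this]
      exact (Commute.refl _).smul_right s
    -- The intertwining relations put `e^{sA} c` in both domains, and `A` commutes with `sA`, so the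
    -- derivative is indeed `A` applied to `e^{sA} c`.
    have h1 := qinner_gen_skew e (lower_coords_expVec e hc (s • q)).symm
      (raise_coords_expVec e hc (s • q)).symm
      (map_coords_expVec_of_commute e hcomm (continuous_gen q) hc (hc.gen q)).symm
    have h2 := congrArg QuaternionAlgebra.re h1
    rw [← star_qinner (expVec e (s • q) c), Quaternion.re_neg, Quaternion.re_star] at h2
    change (qinner _ _).re = 0
    linarith
  have hφ : ∀ s : ℝ, HasDerivAt (fun s : ℝ => ‖expVec e (s • q) c‖ ^ 2) 0 s := by
    intro s
    have := (hd s).norm_sq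
    rwa [hskew, mul_zero] at this
  have hconst := is_const_of_deriv_eq_zero (fun s => (hφ s).differentiableAt)
    (fun s => (hφ s).deriv) 1 0
  simp only [one_smul, zero_smul, expVec_zero_left e hc] at hconst
  exact (pow_left_inj₀ (norm_nonneg _) (norm_nonneg _) two_ne_zero).1 hconst

end Derivative

/-! ### Extension to an isometry of the whole space, its inverse, and strong derivatives. -/

section Extension

theorem sum_star_gen_pow_mul {N : ℕ} {c : ℕ → ℍ[ℝ]} (q : ℍ[ℝ]) (u : ℕ → ℍ[ℝ])
    (k : ℕ) (hc : SupportedBelow N c) :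
    ∑ n ∈ Finset.range (N + k), star ((gen q ^ k) u n) * c n =
      ∑ n ∈ Finset.range (N + k), star (u n) * (gen (-q) ^ k) c n := by
  induction k generalizing N c with
  | zero => rfl
  | succ k ih =>
    have h1 := ih (hc.gen (-q))
    rw [pow_succ' (gen q), pow_succ (gen (-q)), Module.End.mul_apply, Module.End.mul_apply,
      ← add_assoc, sum_star_gen_mul (hc.mono (Nat.le_add_right N k)),
      show N + k + 1 = N + 1 + k by omega, ← h1, ← Finset.sum_neg_distrib]
    refine Finset.sum_congr rfl fun n _ => ?_
    rw [gen_neg]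
    exact (mul_neg _ _).symm

variable {H : Type*} [NormedAddCommGroup H] [NormedSpace ℝ H] [RightInnerProductSpace H]
  (e : OrthonormalBasisSeq H) {N : ℕ} {c : ℕ → ℍ[ℝ]}

theorem continuous_coords_pi : Continuous (coords e) :=
  continuous_pi (continuous_coords e)

variable [CompleteSpace H]

theorem norm_expVec_sub {d : ℕ → ℍ[ℝ]} {M : ℕ} (hc : SupportedBelow N c) (hd : SupportedBelow M d)
    (q : ℍ[ℝ]) : ‖expVec e q c - expVec e q d‖ = ‖synth e c - synth e d‖ := by
  have hc' := hc.mono (le_max_left N M)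
  have hd' := (hd.mono (le_max_right N M)).smul (-1)
  have h1 : expVec e q c - expVec e q d = expVec e q (c + (-1 : ℝ) • d) := by
    rw [expVec_add e hc' hd', expVec_smul e hd]
    module
  have h2 : synth e c - synth e d = synth e (c + (-1 : ℝ) • d) := by
    rw [hc'.synth_add e hd', hd.synth_smul]
    module
  rw [h1, h2, norm_expVec e (hc'.add hd')]

theorem exists_tendsto_expVec_trunc (q : ℍ[ℝ]) (f : H) :
    ∃ g, Tendsto (fun N => expVec e q (trunc N (coords e f))) atTop (𝓝 g) := by
  apply cauchySeq_tendsto_of_complete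
  have h := (tendsto_synth_trunc e f).cauchySeq
  rw [cauchySeq_iff_tendsto_dist_atTop_0] at h ⊢
  refine h.congr fun n => ?_
  rw [dist_eq_norm, dist_eq_norm,
    norm_expVec_sub e (supportedBelow_trunc _ _) (supportedBelow_trunc _ _)]

/-- The isometry of the whole space extending the exponential series of `gen q`. -/
noncomputable def expIsometry (q : ℍ[ℝ]) : H →ₗᵢ[ℝ] H where
  toFun f := (exists_tendsto_expVec_trunc e q f).choose
  map_add' f g := by
    refine tendsto_nhds_unique (exists_tendsto_expVec_trunc e q (f + g)).choose_spec
      (((exists_tendsto_expVec_trunc e q f).choose_spec.add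
        (exists_tendsto_expVec_trunc e q g).choose_spec).congr fun N => ?_)
    rw [map_add, map_add, expVec_add e (supportedBelow_trunc _ _) (supportedBelow_trunc _ _)]
  map_smul' r f := by
    refine tendsto_nhds_unique (exists_tendsto_expVec_trunc e q (r • f)).choose_spec
      (((exists_tendsto_expVec_trunc e q f).choose_spec.const_smul r).congr fun N => ?_)
    rw [map_smul, map_smul, expVec_smul e (supportedBelow_trunc _ _)]
  norm_map' f := by
    refine tendsto_nhds_unique (exists_tendsto_expVec_trunc e q f).choose_spec.norm
      ((tendsto_synth_trunc e f).norm.congr fun N => ?_)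
    rw [norm_expVec e (supportedBelow_trunc _ _)]

theorem tendsto_expVec_trunc (q : ℍ[ℝ]) (f : H) :
    Tendsto (fun N => expVec e q (trunc N (coords e f))) atTop (𝓝 (expIsometry e q f)) :=
  (exists_tendsto_expVec_trunc e q f).choose_spec

theorem expIsometry_synth (hc : SupportedBelow N c) (q : ℍ[ℝ]) :
    expIsometry e q (synth e c) = expVec e q c := by
  refine tendsto_nhds_unique (tendsto_expVec_trunc e q (synth e c))
    (tendsto_const_nhds.congr' ?_)
  filter_upwards [eventually_ge_atTop N] with M hM
  rw [hc.coords_synth, hc.trunc_eq hM]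

theorem eq_of_re_qinner_synth {f g : H} (h : ∀ (N : ℕ) (c : ℕ → ℍ[ℝ]), SupportedBelow N c →
    (qinner (synth e c) f).re = (qinner (synth e c) g).re) : f = g := by
  have h1 : ∀ N, (qinner (f - g) (synth e (trunc N (coords e (f - g))))).re = 0 := by
    intro N
    rw [← star_qinner, Quaternion.re_star]
    have := h N _ (supportedBelow_trunc N (coords e (f - g)))
    rw [← qinnerCLM_apply, map_sub, Quaternion.re_sub, qinnerCLM_apply, qinnerCLM_apply, this,
      sub_self]
  have h2 := (Quaternion.continuous_re.tendsto _).comp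
    (((qinnerCLM (f - g)).continuous.tendsto _).comp (tendsto_synth_trunc e (f - g)))
  have h3 : (qinner (f - g) (f - g)).re = 0 :=
    tendsto_nhds_unique h2 (tendsto_const_nhds.congr fun N => (h1 N).symm)
  rw [qinner_self, Quaternion.re_coe] at h3
  exact sub_eq_zero.1 (norm_eq_zero.1 (pow_eq_zero_iff two_ne_zero |>.1 h3))

/-- Each power of `A` moves to the finite side as a power of `-A`. The result depends on `f` alone,
and `f` need not be finitely supported, nor the convergence absolute. -/
theorem qinner_synth_of_hasSum {f G : H} {g : ℕ → H} {q : ℍ[ℝ]}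
    (hg : ∀ k, coords e (g k) = expTerm q k (coords e f)) (hG : HasSum g G)
    (hc : SupportedBelow N c) : qinner (synth e c) G = qinner (expVec e (-q) c) f := by
  have h1 := ((qinnerCLM (synth e c)).hasSum hG).star
  have h2 := (qinnerCLM f).hasSum (hasSum_expVec e hc (-q))
  rw [← star_qinner f]
  refine (star_star _).symm.trans (congrArg star (h2.unique (h1.congr_fun fun k => ?_)).symm)
  rw [qinnerCLM_apply, qinnerCLM_apply, star_qinner,
    (hc.expTerm (-q) k).qinner_synth, (hc.mono (Nat.le_add_right N k)).qinner_synth, hg]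
  have h3 := congrArg (fun z => (k ! : ℝ)⁻¹ • z) (sum_star_gen_pow_mul q (coords e f) k hc)
  simp only [Finset.smul_sum] at h3
  refine Eq.trans (Finset.sum_congr rfl fun n _ => ?_)
    (h3.symm.trans (Finset.sum_congr rfl fun n _ => ?_))
  · exact mul_smul_comm (k ! : ℝ)⁻¹ _ _
  · change _ = star ((k ! : ℝ)⁻¹ • (gen q ^ k) (coords e f) n) * c n
    rw [Quaternion.star_smul, smul_mul_assoc]

theorem qinner_synth_expIsometry (hc : SupportedBelow N c) (q : ℍ[ℝ]) (f : H) :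
    qinner (synth e c) (expIsometry e q f) = qinner (expVec e (-q) c) f := by
  have h1 := ((qinnerCLM (synth e c)).continuous.tendsto _).comp (tendsto_expVec_trunc e q f)
  have h2 := ((qinnerCLM (expVec e (-q) c)).continuous.tendsto _).comp (tendsto_synth_trunc e f)
  refine tendsto_nhds_unique h1 (h2.congr fun M => ?_)
  have hM := supportedBelow_trunc M (coords e f)
  refine (qinner_synth_of_hasSum e (fun k => ?_) (hasSum_expVec e hM q) hc).symm
  rw [(hM.expTerm q k).coords_synth, hM.coords_synth]

theorem eq_expIsometry_of_hasSum {f G : H} {g : ℕ → H} {q : ℍ[ℝ]}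
    (hg : ∀ k, coords e (g k) = expTerm q k (coords e f)) (hG : HasSum g G) :
    G = expIsometry e q f :=
  eq_of_re_qinner_synth e fun N c hc => by
    rw [qinner_synth_of_hasSum e hg hG hc, qinner_synth_expIsometry e hc]

/-- In the weak sense the adjoint of `e^A` is `e^{-A}`, and an isometry preserves the real inner
product. -/
theorem expIsometry_neg_expIsometry (q : ℍ[ℝ]) (f : H) :
    expIsometry e (-q) (expIsometry e q f) = f := by
  let _ : InnerProductSpace ℝ H := realInnerProductSpace
  refine eq_of_re_qinner_synth e fun N c hc => ?_
  rw [qinner_synth_expIsometry e hc, neg_neg, ← expIsometry_synth e hc]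
  exact (expIsometry e q).inner_map_map (synth e c) f

theorem expIsometry_leftMul {r q : ℍ[ℝ]} (h : Commute r q) (h' : Commute r (star q)) (f : H) :
    expIsometry e q (leftMul e r f) = leftMul e r (expIsometry e q f) := by
  refine coords_injective e ?_
  have h1 := ((continuous_coords_pi e).tendsto _).comp (tendsto_expVec_trunc e q (leftMul e r f))
  have h2 := ((continuous_lmul r).tendsto _).comp
    (((continuous_coords_pi e).tendsto _).comp (tendsto_expVec_trunc e q f))
  rw [coords_leftMul']
  refine tendsto_nhds_unique h1 (h2.congr fun M => ?_)
  simp only [Function.comp_apply]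
  rw [coords_leftMul', ← lmul_trunc, expVec_lmul e h h' (supportedBelow_trunc _ _),
    coords_leftMul']

/-- The relation for truncations passes to the limit coordinatewise, so no norm control of `raise`
on the image is needed; the right-hand side then exhibits a genuine vector, which proves membership
in the domain. -/
theorem raise_coords_expIsometry {f f₂ : H} (h₂ : coords e f₂ = raise (coords e f)) (q : ℍ[ℝ]) :
    raise (coords e (expIsometry e q f)) =
      coords e (expIsometry e q f₂ + leftMul e (star q) (expIsometry e q f)) := by
  have hf := ((continuous_coords_pi e).tendsto _).comp (tendsto_expVec_trunc e q f)
  have hf₂ := ((continuous_coords_pi e).tendsto _).comp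
    ((tendsto_expVec_trunc e q f₂).comp (tendsto_add_atTop_nat 1))
  rw [map_add, coords_leftMul']
  refine tendsto_nhds_unique ((continuous_raise.tendsto _).comp hf)
    ((hf₂.add (((continuous_lmul (star q)).tendsto _).comp hf)).congr fun M => ?_)
  simp only [Function.comp_apply]
  rw [raise_coords_expVec e (supportedBelow_trunc _ _), map_add, coords_leftMul', h₂, raise_trunc]

theorem lower_coords_expIsometry {f f₁ : H} (h₁ : coords e f₁ = lower (coords e f)) (q : ℍ[ℝ]) :
    lower (coords e (expIsometry e q f)) =
      coords e (expIsometry e q f₁ + leftMul e q (expIsometry e q f)) := by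
  have hf := ((continuous_coords_pi e).tendsto _).comp
    ((tendsto_expVec_trunc e q f).comp (tendsto_add_atTop_nat 1))
  have hf₁ := ((continuous_coords_pi e).tendsto _).comp (tendsto_expVec_trunc e q f₁)
  rw [map_add, coords_leftMul']
  refine tendsto_nhds_unique ((continuous_lower.tendsto _).comp hf)
    ((hf₁.add (((continuous_lmul q).tendsto _).comp hf)).congr fun M => ?_)
  simp only [Function.comp_apply]
  rw [lower_coords_expVec e (supportedBelow_trunc _ _), map_add, coords_leftMul', h₁, lower_trunc]

/-- The derivatives for truncations are isometries, depending on `s`, applied to a convergent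
sequence not depending on `s`. Their convergence is thus uniform in `s`, and the limit may be
differentiated. -/
theorem hasDerivAt_expIsometry {f f₁ f₂ : H} (h₁ : coords e f₁ = lower (coords e f))
    (h₂ : coords e f₂ = raise (coords e f)) {p q : ℍ[ℝ]} (h : Commute p q)
    (h' : Commute p (star q)) (s : ℝ) :
    HasDerivAt (fun s : ℝ => expIsometry e (q + s • p) f)
      (expIsometry e (q + s • p) (leftMul e p f₂ - leftMul e (star p) f₁ +
        (1 / 2 : ℝ) • leftMul e (symplectic p q) f)) s := by
  have hs : ∀ M, SupportedBelow (M + 1) (trunc (M + 1) (coords e f)) :=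
    fun M => supportedBelow_trunc _ _
  have hy : Tendsto (fun M => synth e (lmul (symplectic p q) (trunc (M + 1) (coords e f)))) atTop
      (𝓝 (leftMul e (symplectic p q) f)) := by
    refine ((tendsto_synth_trunc e (leftMul e (symplectic p q) f)).comp
      (tendsto_add_atTop_nat 1)).congr fun M => ?_
    rw [Function.comp_apply, coords_leftMul', lmul_trunc]
  have hlim := (tendsto_synth_gen_trunc e h₁ h₂ p).add (hy.const_smul (1 / 2 : ℝ))
  have hF : ∀ (M : ℕ) (s : ℝ), HasDerivAt
      (fun s : ℝ => expVec e (q + s • p) (trunc (M + 1) (coords e f)))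
      (expIsometry e (q + s • p) (synth e (gen p (trunc (M + 1) (coords e f))) +
        (1 / 2 : ℝ) • synth e (lmul (symplectic p q) (trunc (M + 1) (coords e f))))) s := by
    intro M s
    rw [map_add, map_smul, expIsometry_synth e ((hs M).gen p),
      expIsometry_synth e ((hs M).lmul _)]
    exact hasDerivAt_expVec e h h' (hs M) s
  refine hasDerivAt_of_tendstoUniformly
    (f := fun M s => expVec e (q + s • p) (trunc (M + 1) (coords e f)))
    (g' := fun s => expIsometry e (q + s • p) (leftMul e p f₂ - leftMul e (star p) f₁ +
        (1 / 2 : ℝ) • leftMul e (symplectic p q) f))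
    ?_ (Eventually.of_forall hF)
    (fun t => (tendsto_expVec_trunc e (q + t • p) f).comp (tendsto_add_atTop_nat 1)) s
  rw [Metric.tendstoUniformly_iff]
  intro ε hε
  filter_upwards [Metric.tendsto_nhds.1 hlim ε hε] with M hM t
  rw [LinearIsometry.dist_map, dist_comm]
  exact hM

end Extension

/-! ### Identification with the operators of the statement, and the Wirtinger derivatives. -/

section Domains

variable {H : Type*} [NormedAddCommGroup H] [NormedSpace ℝ H] [RightInnerProductSpace H]
  [CompleteSpace H] (e : OrthonormalBasisSeq H)

theorem hasSum_creation {f g : H} : HasSum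
    (fun m : ℕ => op (((√((m : ℝ) + 1) : ℝ) : ℍ[ℝ]) * qinner (e.vec m) f) • e.vec (m + 1)) g ↔
      coords e g = raise (coords e f) := by
  have h1 : ∀ m : ℕ, op (((√((m : ℝ) + 1) : ℝ) : ℍ[ℝ]) * qinner (e.vec m) f) • e.vec (m + 1) =
      op (raise (coords e f) (m + 1)) • e.vec (m + 1) := fun m => by
    rw [raise_apply_succ, Quaternion.coe_mul_eq_smul, coords_apply]
  simp only [h1]
  -- The missing index `0` costs nothing, because the zeroth coordinate of `raise` vanishes.
  rw [hasSum_nat_add_iff (f := fun n => op (raise (coords e f) n) • e.vec n) 1,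
    Finset.sum_range_one, raise_apply_zero, op_zero, zero_smul, add_zero]
  constructor
  · exact coords_of_hasSum e
  · intro h
    rw [← h]
    exact hasSum_coords e g

theorem hasSum_annihilation {f g : H} : HasSum
    (fun m : ℕ => op (((√((m : ℝ) + 1) : ℝ) : ℍ[ℝ]) * qinner (e.vec (m + 1)) f) • e.vec m) g ↔
      coords e g = lower (coords e f) := by
  have h1 : ∀ m : ℕ, op (((√((m : ℝ) + 1) : ℝ) : ℍ[ℝ]) * qinner (e.vec (m + 1)) f) • e.vec m =
      op (lower (coords e f) m) • e.vec m := fun m => by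
    rw [lower_apply, Quaternion.coe_mul_eq_smul, coords_apply]
  simp only [h1]
  constructor
  · exact coords_of_hasSum e
  · intro h
    rw [← h]
    exact hasSum_coords e g

theorem mem_creation_domain {f : H} :
    f ∈ (creation e).domain ↔ ∃ g, coords e g = raise (coords e f) := by
  simp only [← hasSum_creation]
  exact Iff.rfl

theorem mem_annihilation_domain {f : H} :
    f ∈ (annihilation e).domain ↔ ∃ g, coords e g = lower (coords e f) := by
  simp only [← hasSum_annihilation]
  exact Iff.rfl

theorem coords_creation (f : (creation e).domain) :
    coords e (creation e f) = raise (coords e (f : H)) := by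
  have h : Summable fun m : ℕ =>
    op (((√((m : ℝ) + 1) : ℝ) : ℍ[ℝ]) * qinner (e.vec m) (f : H)) • e.vec (m + 1) := f.2
  exact (hasSum_creation e).1 h.hasSum

theorem coords_annihilation (f : (annihilation e).domain) :
    coords e (annihilation e f) = lower (coords e (f : H)) := by
  have h : Summable fun m : ℕ =>
    op (((√((m : ℝ) + 1) : ℝ) : ℍ[ℝ]) * qinner (e.vec (m + 1)) (f : H)) • e.vec m := f.2
  exact (hasSum_annihilation e).1 h.hasSum

/-- Both domains are given by `∑ n ‖cₙ‖² < ∞`: the weights `n + 1` and `n` differ by a series that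
converges by Bessel's inequality. -/
theorem creation_domain_eq : (creation e).domain = (annihilation e).domain := by
  ext f
  rw [mem_creation_domain, mem_annihilation_domain, exists_coords_iff_sq, exists_coords_iff_sq,
    ← summable_nat_add_iff 1]
  have hb : Summable fun n : ℕ => ‖coords e f n‖ ^ 2 := bessel e f
  have h1 : ∀ n : ℕ, ‖raise (coords e f) (n + 1)‖ ^ 2 =
      (n : ℝ) * ‖coords e f n‖ ^ 2 + ‖coords e f n‖ ^ 2 := fun n => by
    rw [raise_apply_succ, norm_smul, mul_pow, Real.norm_of_nonneg (Real.sqrt_nonneg _),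
      Real.sq_sqrt (by positivity)]
    ring
  have h2 : ∀ n : ℕ, ‖lower (coords e f) n‖ ^ 2 =
      ((n + 1 : ℕ) : ℝ) * ‖coords e f (n + 1)‖ ^ 2 := fun n => by
    rw [lower_apply, norm_smul, mul_pow, Real.norm_of_nonneg (Real.sqrt_nonneg _),
      Real.sq_sqrt (by positivity)]
    push_cast
    ring
  simp only [h1, h2]
  rw [summable_nat_add_iff (f := fun n : ℕ => (n : ℝ) * ‖coords e f n‖ ^ 2) 1]
  exact ⟨fun h => by simpa using h.sub hb, fun h => h.add hb⟩

theorem mem_displacementGenerator_domain {q : ℍ[ℝ]} {f : H} :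
    f ∈ (displacementGenerator e q).domain ↔
      f ∈ (creation e).domain ∧ f ∈ (annihilation e).domain := Iff.rfl

theorem coords_applyTotal {q : ℍ[ℝ]} {f : H} (hf : f ∈ (displacementGenerator e q).domain) :
    coords e (applyTotal (displacementGenerator e q) f) = gen q (coords e f) := by
  have h1 := (mem_displacementGenerator_domain e).1 hf
  rw [applyTotal, dif_pos hf, gen_coords e (coords_annihilation e ⟨f, h1.2⟩)
    (coords_creation e ⟨f, h1.1⟩)]
  rfl

theorem synth_mem_displacementGenerator_domain {N : ℕ} {c : ℕ → ℍ[ℝ]} (hc : SupportedBelow N c)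
    (q : ℍ[ℝ]) : synth e c ∈ (displacementGenerator e q).domain := by
  rw [mem_displacementGenerator_domain, mem_creation_domain, mem_annihilation_domain,
    hc.coords_synth]
  exact ⟨⟨_, hc.raise.coords_synth e⟩, ⟨_, hc.lower.coords_synth e⟩⟩

theorem applyTotal_iterate_synth {N : ℕ} {c : ℕ → ℍ[ℝ]} (hc : SupportedBelow N c)
    (q : ℍ[ℝ]) (k : ℕ) :
    (applyTotal (displacementGenerator e q))^[k] (synth e c) = synth e ((gen q ^ k) c) := by
  induction k with
  | zero => rfl
  | succ k ih =>
    rw [Function.iterate_succ_apply', ih, eq_comm, (hc.gen_pow q (k + 1)).synth_eq_iff,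
      coords_applyTotal e (synth_mem_displacementGenerator_domain e (hc.gen_pow q k) q),
      (hc.gen_pow q k).coords_synth, pow_succ']
    rfl

theorem synth_mem_expDomain {N : ℕ} {c : ℕ → ℍ[ℝ]} (hc : SupportedBelow N c) (q : ℍ[ℝ]) :
    synth e c ∈ expDomain (displacementGenerator e q) := by
  refine ⟨fun k => ?_, ?_⟩
  · rw [applyTotal_iterate_synth e hc]
    exact synth_mem_displacementGenerator_domain e (hc.gen_pow q k) q
  · refine Summable.of_nonneg_of_le (fun k => by positivity) (fun k => ?_)
      ((summable_expBound N (norm_nonneg q)).mul_right (∑ n ∈ Finset.range N, ‖c n‖))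
    refine le_trans (le_of_eq ?_) (norm_synth_expTerm_le e hc (le_refl ‖q‖) k)
    have : expTerm q k c = (k ! : ℝ)⁻¹ • (gen q ^ k) c := rfl
    rw [applyTotal_iterate_synth e hc, this, (hc.gen_pow q k).synth_smul, norm_smul,
      Real.norm_of_nonneg (by positivity), div_eq_inv_mul]

/-- Agreement on all of `expDomain`, not only on finite vectors, is what makes the extension by
continuity exist. -/
theorem expSeries_eq_expIsometry {q : ℍ[ℝ]} {f : H}
    (hf : f ∈ expDomain (displacementGenerator e q)) :
    expSeries (displacementGenerator e q) f = expIsometry e q f := by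
  have hs : Summable fun k : ℕ =>
      (k ! : ℝ)⁻¹ • (applyTotal (displacementGenerator e q))^[k] f := by
    refine Summable.of_norm (hf.2.congr fun k => ?_)
    rw [norm_smul, Real.norm_of_nonneg (by positivity), div_eq_inv_mul]
  refine eq_expIsometry_of_hasSum e (fun k => ?_) hs.hasSum
  have hk : ∀ k, coords e ((applyTotal (displacementGenerator e q))^[k] f) =
      (gen q ^ k) (coords e f) := by
    intro k
    induction k with
    | zero => rfl
    | succ k ih =>
      rw [Function.iterate_succ_apply', coords_applyTotal e (hf.1 k), ih, pow_succ']
      rfl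
  rw [map_smul, hk]
  rfl

theorem dense_expDomain (q : ℍ[ℝ]) : Dense (expDomain (displacementGenerator e q)) := fun f =>
  mem_closure_of_tendsto (tendsto_synth_trunc e f)
    (Eventually.of_forall fun _ => synth_mem_expDomain e (supportedBelow_trunc _ _) q)

theorem tendsto_expSeries (q : ℍ[ℝ]) (f : H) :
    Tendsto (expSeries (displacementGenerator e q)) (𝓝[expDomain (displacementGenerator e q)] f)
      (𝓝 (expIsometry e q f)) :=
  (((expIsometry e q).continuous.tendsto f).mono_left nhdsWithin_le_nhds).congr'
    (eventually_nhdsWithin_of_forall fun _ hg => (expSeries_eq_expIsometry e hg).symm)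

theorem displacement_eq (q : ℍ[ℝ]) (f : H) : displacement e q f = expIsometry e q f :=
  extendFrom_eq (dense_expDomain e q f) (tendsto_expSeries e q f)

theorem expWellDefined_displacementGenerator (q : ℍ[ℝ]) :
    ExpWellDefined (displacementGenerator e q) := by
  refine ⟨dense_expDomain e q, fun f => ?_⟩
  have h := tendsto_expSeries e q f
  rwa [← displacement_eq e q f] at h

theorem displacement_mem_creation_domain (q : ℍ[ℝ]) (f : H) :
    displacement e q f ∈ (creation e).domain ↔ f ∈ (creation e).domain := by
  have key : ∀ (q : ℍ[ℝ]) (f : H), f ∈ (creation e).domain →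
      expIsometry e q f ∈ (creation e).domain := by
    intro q f hf
    rw [mem_creation_domain] at hf ⊢
    obtain ⟨g, hg⟩ := hf
    exact ⟨_, (raise_coords_expIsometry e hg q).symm⟩
  rw [displacement_eq]
  refine ⟨fun h => ?_, key q f⟩
  -- The converse is the same invariance for the inverse operator `e^{-A}`.
  have := key (-q) _ h
  rwa [expIsometry_neg_expIsometry] at this

theorem displacement_mem_annihilation_domain (q : ℍ[ℝ]) (f : H) :
    displacement e q f ∈ (annihilation e).domain ↔ f ∈ (annihilation e).domain := by
  rw [← creation_domain_eq]
  exact displacement_mem_creation_domain e q f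

theorem sliceDisplacement_wirtinger {τ : ℍ[ℝ]} (hτ : τ ∈ imaginarySphere) (x y : ℝ) {f : H}
    (hc : sliceDisplacement e τ x y f ∈ (creation e).domain)
    (ha : sliceDisplacement e τ x y f ∈ (annihilation e).domain) :
    ∃ dx dy : H,
      HasDerivAt (fun s : ℝ => sliceDisplacement e τ s y f) dx x ∧
      HasDerivAt (fun s : ℝ => sliceDisplacement e τ x s f) dy y ∧
      (1 / 2 : ℝ) • (dx - leftMul e τ dy) =
        creation e ⟨sliceDisplacement e τ x y f, hc⟩ -
          (1 / 2 : ℝ) • leftMul e (star (slicePoint τ x y)) (sliceDisplacement e τ x y f) ∧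
      (1 / 2 : ℝ) • (dx + leftMul e τ dy) =
        -(annihilation e ⟨sliceDisplacement e τ x y f, ha⟩ -
          (1 / 2 : ℝ) • leftMul e (slicePoint τ x y) (sliceDisplacement e τ x y f)) := by
  have hfc := (displacement_mem_creation_domain e _ f).1 hc
  have hfa := (displacement_mem_annihilation_domain e _ f).1 ha
  have h₂ := coords_creation e ⟨f, hfc⟩
  have h₁ := coords_annihilation e ⟨f, hfa⟩
  set f₂ := creation e ⟨f, hfc⟩
  set f₁ := annihilation e ⟨f, hfa⟩
  have hstar : star τ = -τ := by
    ext <;> simp [hτ.1]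
  have hsq : τ * τ = -1 := by
    have h := Quaternion.star_mul_self (a := τ)
    rw [hstar, Quaternion.normSq_def', hτ.1] at h
    have h1 : (0 : ℝ) ^ 2 + τ.imI ^ 2 + τ.imJ ^ 2 + τ.imK ^ 2 = 1 := by linarith [hτ.2]
    rw [h1, Quaternion.coe_one, neg_mul] at h
    rw [← h, neg_neg]
  have hcoe : ∀ s : ℝ, (s : ℍ[ℝ]) = s • (1 : ℍ[ℝ]) := fun s => by
    rw [← Quaternion.coe_mul_eq_smul, mul_one]
  have hmul : ∀ s : ℝ, τ * (s : ℍ[ℝ]) = s • τ := fun s => by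
    rw [hcoe, mul_smul_comm, mul_one]
  have hqx : ∀ s : ℝ, slicePoint τ s y = y • τ + s • (1 : ℍ[ℝ]) := fun s => by
    rw [slicePoint, hmul, hcoe, add_comm]
  have hqy : ∀ s : ℝ, slicePoint τ x s = x • (1 : ℍ[ℝ]) + s • τ := fun s => by
    rw [slicePoint, hmul, hcoe]
  have hstarq : star (slicePoint τ x y) = x • (1 : ℍ[ℝ]) - y • τ := by
    rw [hqy, star_add, Quaternion.star_smul, Quaternion.star_smul, star_one, hstar, smul_neg,
      sub_eq_add_neg]
  have hs1 : symplectic 1 (y • τ) = -((2 * y) • τ) := by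
    rw [symplectic, Quaternion.star_smul, star_one, hstar, one_mul, one_mul]
    module
  have hs2 : symplectic τ (x • (1 : ℍ[ℝ])) = (2 * x) • τ := by
    rw [symplectic, Quaternion.star_smul, star_one, hstar, mul_smul_comm, mul_smul_comm, mul_one,
      mul_one]
    module
  have hτq : Commute τ (slicePoint τ x y) := by
    rw [hqy]
    exact ((Commute.one_right τ).smul_right x).add_right ((Commute.refl τ).smul_right y)
  have hτq' : Commute τ (star (slicePoint τ x y)) := by
    rw [hstarq]
    exact ((Commute.one_right τ).smul_right x).sub_right ((Commute.refl τ).smul_right y)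
  -- The point `x + τ y` is read as `τ y + x · 1` for the `x` derivative and as `x + y τ` for the
  -- `y` derivative; the central terms are then `-2yτ` and `2xτ`.
  have hdx := hasDerivAt_expIsometry e h₁ h₂ (p := 1) (q := y • τ) (Commute.one_left _)
    (Commute.one_left _) x
  have hdy := hasDerivAt_expIsometry e h₁ h₂ (p := τ) (q := x • (1 : ℍ[ℝ]))
    ((Commute.one_right τ).smul_right x)
    (by rw [Quaternion.star_smul, star_one]; exact (Commute.one_right τ).smul_right x) y
  simp only [← hqx] at hdx
  simp only [← hqy] at hdy
  have hcomm1 : ∀ r s : ℝ, Commute (r • (1 : ℍ[ℝ]) + s • τ) (slicePoint τ x y) ∧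
      Commute (r • (1 : ℍ[ℝ]) + s • τ) (star (slicePoint τ x y)) := fun r s =>
    ⟨((Commute.one_left _).smul_left r).add_left (hτq.smul_left s),
      ((Commute.one_left _).smul_left r).add_left (hτq'.smul_left s)⟩
  -- All multipliers that occur lie in `ℂ_τ`, hence commute with `q` and `q̄` and can be pulled out
  -- of the isometry.
  have hU : ∀ (r : ℍ[ℝ]) (a b : ℝ), r = a • (1 : ℍ[ℝ]) + b • τ → ∀ g : H,
      expIsometry e (slicePoint τ x y) (leftMul e r g) =
        leftMul e r (expIsometry e (slicePoint τ x y) g) := by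
    rintro r a b rfl g
    exact expIsometry_leftMul e (hcomm1 a b).1 (hcomm1 a b).2 g
  have hcr : creation e ⟨sliceDisplacement e τ x y f, hc⟩ =
      expIsometry e (slicePoint τ x y) f₂ +
        leftMul e (star (slicePoint τ x y)) (expIsometry e (slicePoint τ x y) f) := by
    refine coords_injective e ?_
    rw [coords_creation, ← raise_coords_expIsometry e h₂]
    exact congrArg (fun g => raise (coords e g)) (displacement_eq e _ f)
  have han : annihilation e ⟨sliceDisplacement e τ x y f, ha⟩ =
      expIsometry e (slicePoint τ x y) f₁ +
        leftMul e (slicePoint τ x y) (expIsometry e (slicePoint τ x y) f) := by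
    refine coords_injective e ?_
    rw [coords_annihilation, ← lower_coords_expIsometry e h₁]
    exact congrArg (fun g => lower (coords e g)) (displacement_eq e _ f)
  rw [map_add, map_sub, map_smul, hU 1 1 0 (by module), hU (star 1) 1 0 (by rw [star_one]; module),
    hU (symplectic 1 _) 0 (-(2 * y)) (by rw [hs1]; module)] at hdx
  rw [map_add, map_sub, map_smul, hU τ 0 1 (by module), hU (star τ) 0 (-1) (by rw [hstar]; module),
    hU (symplectic τ _) 0 (2 * x) (by rw [hs2]; module)] at hdy
  refine ⟨_, _, hdx.congr_of_eventuallyEq (Eventually.of_forall fun s => displacement_eq e _ f),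
    hdy.congr_of_eventuallyEq (Eventually.of_forall fun s => displacement_eq e _ f), ?_, ?_⟩
  · rw [hcr, show sliceDisplacement e τ x y f = _ from displacement_eq e _ f, hstarq, hs1, hs2]
    -- With `U` for the isometry, `∂x - τ ∂y` gives `2 U a† f + (x - τ y) U f`: the `a` terms cancel
    -- by `τ² = -1`. Half of it equals `a† U f - ½ q̄ U f`.
    refine coords_injective e (funext fun n => ?_)
    simp only [map_sub, map_add, map_smul, Pi.sub_apply, Pi.add_apply, Pi.smul_apply,
      coords_leftMul, star_one, hstar, one_mul, sub_mul, neg_mul, mul_neg, smul_mul_assoc, mul_smul_comm,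
      ← mul_assoc, hsq]
    module
  · rw [han, show sliceDisplacement e τ x y f = _ from displacement_eq e _ f, hqy, hs1, hs2]
    -- Here the `a†` terms cancel, leaving half of `-2 U a f - q U f`, which is `-(a U f - ½ q U
    -- f)`.
    refine coords_injective e (funext fun n => ?_)
    simp only [map_neg, map_sub, map_add, map_smul, Pi.neg_apply, Pi.sub_apply, Pi.add_apply,
      Pi.smul_apply, coords_leftMul, star_one, hstar, one_mul, add_mul,
      neg_mul, mul_neg, smul_mul_assoc, mul_smul_comm, ← mul_assoc, hsq]
    module

end Domains

end QuaternionicFock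

/-! ### The theorem: since the two domains coincide, both identities come from one computation. -/

theorem mainTheorem12 {H : Type*} [NormedAddCommGroup H] [NormedSpace ℝ H] [CompleteSpace H]
    [QuaternionicFock.RightInnerProductSpace H] (e : QuaternionicFock.OrthonormalBasisSeq H)
    (τ : ℍ[ℝ]) (hτ : τ ∈ QuaternionicFock.imaginarySphere) (x y : ℝ) :
    -- the exponential defining `D_τ(q)` exists, for `q = x + τ y`
    QuaternionicFock.ExpWellDefined
      (QuaternionicFock.displacementGenerator e (QuaternionicFock.slicePoint τ x y)) ∧
    -- (i) on the domain of `a†`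
    (∀ f : H,
      (QuaternionicFock.sliceDisplacement e τ x y f ∈ (QuaternionicFock.creation e).domain ↔
        f ∈ (QuaternionicFock.creation e).domain)) ∧
    (∀ (f : H)
      (hf : QuaternionicFock.sliceDisplacement e τ x y f ∈ (QuaternionicFock.creation e).domain),
      ∃ dx dy : H,
        HasDerivAt (fun s : ℝ => QuaternionicFock.sliceDisplacement e τ s y f) dx x ∧
        HasDerivAt (fun s : ℝ => QuaternionicFock.sliceDisplacement e τ x s f) dy y ∧
        (1 / 2 : ℝ) • (dx - QuaternionicFock.leftMul e τ dy) =
          QuaternionicFock.creation e ⟨QuaternionicFock.sliceDisplacement e τ x y f, hf⟩ -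
            (1 / 2 : ℝ) • QuaternionicFock.leftMul e (star (QuaternionicFock.slicePoint τ x y))
              (QuaternionicFock.sliceDisplacement e τ x y f)) ∧
    -- (ii) on the domain of `a`
    (∀ f : H,
      (QuaternionicFock.sliceDisplacement e τ x y f ∈ (QuaternionicFock.annihilation e).domain ↔
        f ∈ (QuaternionicFock.annihilation e).domain)) ∧
    (∀ (f : H)
      (hf : QuaternionicFock.sliceDisplacement e τ x y f ∈
        (QuaternionicFock.annihilation e).domain),
      ∃ dx dy : H,
        HasDerivAt (fun s : ℝ => QuaternionicFock.sliceDisplacement e τ s y f) dx x ∧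
        HasDerivAt (fun s : ℝ => QuaternionicFock.sliceDisplacement e τ x s f) dy y ∧
        (1 / 2 : ℝ) • (dx + QuaternionicFock.leftMul e τ dy) =
          -(QuaternionicFock.annihilation e ⟨QuaternionicFock.sliceDisplacement e τ x y f, hf⟩ -
            (1 / 2 : ℝ) • QuaternionicFock.leftMul e (QuaternionicFock.slicePoint τ x y)
              (QuaternionicFock.sliceDisplacement e τ x y f))) := by
  refine ⟨QuaternionicFock.expWellDefined_displacementGenerator e _,
    QuaternionicFock.displacement_mem_creation_domain e _, fun f hc => ?_,
    QuaternionicFock.displacement_mem_annihilation_domain e _, fun f ha => ?_⟩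
  · have ha := hc
    rw [QuaternionicFock.creation_domain_eq] at ha
    obtain ⟨dx, dy, hx, hy, h, -⟩ := QuaternionicFock.sliceDisplacement_wirtinger e hτ x y hc ha
    exact ⟨dx, dy, hx, hy, h⟩
  · have hc := ha
    rw [← QuaternionicFock.creation_domain_eq] at hc
    obtain ⟨dx, dy, hx, hy, -, h⟩ := QuaternionicFock.sliceDisplacement_wirtinger e hτ x y hc ha
    exact ⟨dx, dy, hx, hy, h⟩
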